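/- **Setting.** Let $D\ge 1$, let $\Theta\subseteq\mathbb{R}^D$ be measurable, and let $\pi_0$ be a probability density on $\Theta$ (with respect to Lebesgue measure). Let $X,x_1,x_2,\dots$ be i.i.d. with law $p$ on a measurable space $\mathcal X$, and let $f:\mathcal X\times\Theta\to\mathbb{R}$ be a potential, measurable in $x$, with $f(X,\theta)$ integrable for every $\theta\in\Theta$; put $f_n=f(x_n,\cdot)$ and $\bar f(\theta)=\mathbb{E}_p f(X,\theta)$. Let $\theta_0\in\Theta$ be the maximizer of $\bar f$ over $\Theta$. For $w\in\mathbb{R}_{\ge0}^N$ let $\pi_w$ be the distribution on $\Theta$ with density $\pi_w(\theta)=Z(w)^{-1}\exp\big(\sum_{n=1}^N w_nf_n(\theta)\big)\pi_0(\theta)$, where $Z(w)$ is the normalizing constant, and let $\pi=\pi_{(1,\dots,1)}$. For $S\subseteq\{1,\dots,N\}$ let $\mathcal W_N=\mathcal W_N(S)=\{w\in\mathbb{R}_{\ge0}^N:\ w_n=0\text{ for }n\notin S,\ \sum_n w_n=N\}$. **Assumptions.** Suppose $f=f^{(1)}+f^{(2)}$, where $f^{(1)}$ is measurable in $x$ and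 the functions $f^{(1)}(x,\cdot)-f^{(1)}(x,\theta_0)$, $x\in\mathcal X$, span a finite-dimensional vector space of functions on $\Theta$, and that there are constants $\epsilon_0,L_0,L_1,L_2>0$ such that (with $\theta$ ranging over $\Theta$): * **A1.** For all $x$, $f(x,\cdot)$ is differentiable and strongly concave with constant $L_0$ on $\Theta$ (in particular $\Theta$ is convex), i.e. $f(x,a\theta+b\theta')\ge af(x,\theta)+bf(x,\theta')+\tfrac{L_0}{2}ab\|\theta-\theta'\|^2$ for $a,b\ge0$, $a+b=1$. * **A2.** For all $x$, all $0<\epsilon<\epsilon_0$ and all $\|\theta-\theta_0\|\le\epsilon$, $|f^{(2)}(x,\theta)|\le R(x)\,r(\epsilon)\,\|\theta-\theta_0\|^2$, where $R$ and $r$ are positive functions, $r$ is monotone increasing on $(0,\epsilon_0]$ with $\lim_{\epsilon\to0}r(\epsilon)=0$, $4r(\epsilon_0)\big[\mathbb{E}_pR(X)+1\big]\le L_0$ and $\mathbb{E}_p\big[R(X)^2\big]<\infty$. * **A3.** For all $\|\theta-\theta_0\|\le\epsilon_0$, $\bar f(\theta_0)-\bar f(\theta)\le L_1\|\theta-\theta_0\|^2$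 and $\mathrm{Var}_p\big(f(X,\theta_0)-f(X,\theta)\big)\le L_2\|\theta-\theta_0\|^2$. * **A4.** $\inf_{\|\theta-\theta_0\|\le\epsilon_0}\pi_0(\theta)>0$ and $\sup_\theta\pi_0(\theta)<\infty$. * **Moment condition.** $\int_\Theta \mathrm{Var}_p\big(f(X,\theta_0)-f(X,\theta)\big)\,e^{-K\|\theta-\theta_0\|^2}\,\pi_0(\theta)\,d\theta<\infty$ for some $K\ge0$. **Theorem.** Let $M=M_N\le N$ satisfy $M\gtrsim D(\log N+1)$, that is, for some constant $c>0$, $M_N\ge c\,D(\log N+1)$ for all large $N$. Let $S$ be a uniformly random subset of $\{1,\dots,N\}$ of size $M_N$, independent of the data. Then, as $N\to\infty$, with probability at least $1-o(1)$ the minimum below is attained and $$\min_{w\in\mathcal W_N}\mathrm{KL}(\pi_w\,\|\,\pi)=o(1),$$ i.e. there is a deterministic sequence $\kappa_N\to0$ such that the probability that $\min_{w\in\mathcal W_N}\mathrm{KL}(\pi_w\|\pi)\le\kappa_N$ tends to $1$. -/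

import Mathlib

open MeasureTheory ProbabilityTheory Filter Topology
open scoped ENNReal

/-- The expected potential `f̄(θ) = 𝔼_p f(X, θ)`. -/
noncomputable def meanPotential {𝒳 E : Type*} [MeasurableSpace 𝒳] (p : Measure 𝒳)
    (f : 𝒳 → E → ℝ) (θ : E) : ℝ :=
  ∫ x, f x θ ∂p

/-- The Lebesgue density on `Θ`, up to normalization, of the posterior of the weighted data
`x 0, …, x (N - 1)` with weights `w`: `exp (∑ n, w n * f (x n) θ) * π₀ θ`. -/
noncomputable def unnormalizedDensity {𝒳 : Type*} {D N : ℕ}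
    (f : 𝒳 → EuclideanSpace ℝ (Fin D) → ℝ) (π₀ : EuclideanSpace ℝ (Fin D) → ℝ)
    (x : Fin N → 𝒳) (w : Fin N → ℝ) (θ : EuclideanSpace ℝ (Fin D)) : ℝ≥0∞ :=
  ENNReal.ofReal (Real.exp (∑ n, w n * f (x n) θ) * π₀ θ)

/-- The normalizing constant `Z(w)`. -/
noncomputable def normalizingConstant {𝒳 : Type*} {D N : ℕ}
    (Θ : Set (EuclideanSpace ℝ (Fin D)))
    (f : 𝒳 → EuclideanSpace ℝ (Fin D) → ℝ) (π₀ : EuclideanSpace ℝ (Fin D) → ℝ)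
    (x : Fin N → 𝒳) (w : Fin N → ℝ) : ℝ≥0∞ :=
  ∫⁻ θ in Θ, unnormalizedDensity f π₀ x w θ

/-- The weighted posterior `π_w` on `Θ`, with Lebesgue density
`Z(w)⁻¹ * exp (∑ n, w n * f (x n) θ) * π₀ θ`. -/
noncomputable def coresetPosterior {𝒳 : Type*} {D N : ℕ}
    (Θ : Set (EuclideanSpace ℝ (Fin D)))
    (f : 𝒳 → EuclideanSpace ℝ (Fin D) → ℝ) (π₀ : EuclideanSpace ℝ (Fin D) → ℝ)
    (x : Fin N → 𝒳) (w : Fin N → ℝ) : Measure (EuclideanSpace ℝ (Fin D)) :=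
  (volume.restrict Θ).withDensity
    (fun θ => (normalizingConstant Θ f π₀ x w)⁻¹ * unnormalizedDensity f π₀ x w θ)

/-- The full posterior `π`: all the weights are `1`. -/
noncomputable def fullPosterior {𝒳 : Type*} {D N : ℕ}
    (Θ : Set (EuclideanSpace ℝ (Fin D)))
    (f : 𝒳 → EuclideanSpace ℝ (Fin D) → ℝ) (π₀ : EuclideanSpace ℝ (Fin D) → ℝ)
    (x : Fin N → 𝒳) : Measure (EuclideanSpace ℝ (Fin D)) :=
  coresetPosterior Θ f π₀ x (fun _ => 1)

/-- The constraint set `𝒲_N` for the selected subset `S` of the indices: non-negative weights,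
supported in `S`, that sum to `N`. -/
def coresetWeights {N : ℕ} (S : Finset (Fin N)) : Set (Fin N → ℝ) :=
  {w | (∀ n, 0 ≤ w n) ∧ (∀ n, n ∉ S → w n = 0) ∧ ∑ n, w n = (N : ℝ)}

/-- The set of the values `KL(π_w ‖ π)`, `w ∈ 𝒲_N`, for the data `x` and the selected subset
`S`. -/
noncomputable def coresetKLValues {𝒳 : Type*} {D N : ℕ}
    (Θ : Set (EuclideanSpace ℝ (Fin D)))
    (f : 𝒳 → EuclideanSpace ℝ (Fin D) → ℝ) (π₀ : EuclideanSpace ℝ (Fin D) → ℝ)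
    (x : Fin N → 𝒳) (S : Finset (Fin N)) : Set ℝ≥0∞ :=
  (fun w => InformationTheory.klDiv (coresetPosterior Θ f π₀ x w) (fullPosterior Θ f π₀ x)) ''
    coresetWeights S

/-- The joint law of `N` i.i.d. data points from `p` and of an independent subset of the indices
that is uniformly distributed over the subsets of size `M`. -/
noncomputable def sampleLaw {𝒳 : Type*} [MeasurableSpace 𝒳] (p : Measure 𝒳) (N M : ℕ) :
    Measure ((Fin N → 𝒳) × Finset (Fin N)) :=
  (Measure.pi (fun _ : Fin N => p)).prod (uniformOn {S : Finset (Fin N) | S.card = M})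

/-- The vector space of functions on `Θ` spanned by `f₁(x, ·) - f₁(x, θ₀)`, `x ∈ 𝒳`. -/
def differenceSpan {𝒳 : Type*} {D : ℕ} (Θ : Set (EuclideanSpace ℝ (Fin D)))
    (f₁ : 𝒳 → EuclideanSpace ℝ (Fin D) → ℝ) (θ₀ : EuclideanSpace ℝ (Fin D)) :
    Submodule ℝ (Θ → ℝ) :=
  Submodule.span ℝ (Set.range (fun x : 𝒳 => fun θ : Θ => f₁ x θ - f₁ x θ₀))

/-! Write g_w = ∑ w_n (f(x_n, ·) - f(x_n, θ₀)). The posterior `π_w` is the tilt of the prior by g_w,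
and KL(π_w ‖ π) is at most the sum of the means of |g_w - g_1| under `π_w` and under `π`. So it is
enough to exhibit one admissible w for which g_w - g_1 is small where these two measures live,
namely at distance of order 1/√N from θ₀.

Near θ₀ the differences of f₁ are m(θ) + ⟨b(θ), e(x)⟩ for a white random vector e in finite
dimension, because their span is finite-dimensional (`exists_isWhite_expansion`). If ∑ w_n = N and ∑
w_n e(x_n) = ∑ e(x_n), the f₁-parts of g_w and g_1 cancel exactly. Such w exist
(`exists_coresetWeights_sum_eq`): the right side is O(√N) with high probability, whereas the
attainable sums ∑ w_n e(x_n) contain a ball of radius proportional to N. Indeed a white vector has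
mass in every open half-space, compactness of the sphere reduces this to finitely many events of
positive probability, and M_N → ∞ makes the selected points hit all of them.

What remains is ∑ (w_n - 1) f₂(x_n, θ). Since R is also affine in e, matching e controls ∑ w_n
R(x_n) by a multiple of N, and the remainder is at most a multiple of r(ε) N ‖θ - θ₀‖². Strong
concavity with constant N L₀ gives N ‖θ - θ₀‖² a bounded mean under both posteriors, and beyond
distance ε an exponentially small factor beats the polynomially bounded Gaussian moment supplied by
the moment condition (`exists_lintegral_tilted_le`). The divergence is thus O(r(ε)) up to a term
that vanishes with N, for every small fixed ε.

Attainment follows from compactness of the weights and lower semicontinuity of the divergence. A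
diagonal argument turns the fixed levels into one sequence κ_N → 0. -/

/-! ### Divergence between exponential tilts. -/

section KullbackLeibler

variable {α : Type*} {mα : MeasurableSpace α}

/-- The divergence of an exponential tilt from the original measure is at most the sum of the mean
absolute log-tilts under the two measures. -/
lemma klDiv_tilted_le_lintegral_add {μ : Measure α} [IsProbabilityMeasure μ] {h : α → ℝ}
    (hexp : Integrable (fun x => Real.exp (h x)) μ) :
    InformationTheory.klDiv (μ.tilted h) μ ≤ ∫⁻ x, ‖h x‖ₑ ∂(μ.tilted h) + ∫⁻ x, ‖h x‖ₑ ∂μ := by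
  have hm : AEMeasurable h μ := Real.aemeasurable_of_aemeasurable_exp hexp.1.aemeasurable
  by_cases h1 : ∫⁻ x, ‖h x‖ₑ ∂(μ.tilted h) = ∞
  · simp [h1]
  by_cases h2 : ∫⁻ x, ‖h x‖ₑ ∂μ = ∞
  · simp [h2]
  have hac : μ.tilted h ≪ μ := tilted_absolutelyContinuous μ h
  have i2 : Integrable h μ := ⟨hm.aestronglyMeasurable, lt_top_iff_ne_top.2 h2⟩
  have i1 : Integrable h (μ.tilted h) :=
    ⟨(hm.mono_ac hac).aestronglyMeasurable, lt_top_iff_ne_top.2 h1⟩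
  have := isProbabilityMeasure_tilted hexp
  have hllr : llr (μ.tilted h) μ =ᵐ[μ.tilted h]
      fun x => h x - Real.log (∫ y, Real.exp (h y) ∂μ) :=
    hac.ae_le (log_rnDeriv_tilted_left_self hexp)
  have hint : Integrable (llr (μ.tilted h) μ) (μ.tilted h) :=
    (integrable_congr hllr).2 (i1.sub (integrable_const _))
  rw [InformationTheory.klDiv_of_ac_of_integrable hac hint, integral_congr_ae hllr,
    integral_sub i1 (integrable_const _)]
  simp only [integral_const, probReal_univ, smul_eq_mul, one_mul, add_sub_cancel_right]
  -- The divergence is the tilted mean of h minus the log-normalizer; Jensen bounds the latter below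
  -- by the mean of h under μ.
  have hjensen : ∫ x, h x ∂μ ≤ Real.log (∫ y, Real.exp (h y) ∂μ) := by
    rw [Real.le_log_iff_exp_le (integral_exp_pos hexp)]
    exact convexOn_exp.map_integral_le Real.continuous_exp.continuousOn isClosed_univ
      (by simp) i2 hexp
  have b1 : ∫ x, h x ∂(μ.tilted h) ≤ ∫ x, ‖h x‖ ∂(μ.tilted h) :=
    (Real.le_norm_self _).trans (norm_integral_le_integral_norm _)
  have b2 : -∫ x, h x ∂μ ≤ ∫ x, ‖h x‖ ∂μ :=
    (neg_le_abs _).trans (norm_integral_le_integral_norm h)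
  rw [← ofReal_integral_norm_eq_lintegral_enorm i1, ← ofReal_integral_norm_eq_lintegral_enorm i2,
    ← ENNReal.ofReal_add (by positivity) (by positivity)]
  exact ENNReal.ofReal_le_ofReal (by linarith)

/-- The tilt by g' is the tilt by g' - g of the tilt by g, so the preceding bound applies with the
latter as base measure. -/
lemma klDiv_tilted_tilted_le {μ : Measure α} [IsProbabilityMeasure μ] {g g' : α → ℝ}
    (hg : Integrable (fun x => Real.exp (g x)) μ) (hg' : Integrable (fun x => Real.exp (g' x)) μ) :
    InformationTheory.klDiv (μ.tilted g') (μ.tilted g) ≤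
      ∫⁻ x, ‖g' x - g x‖ₑ ∂(μ.tilted g') + ∫⁻ x, ‖g' x - g x‖ₑ ∂(μ.tilted g) := by
  have := isProbabilityMeasure_tilted hg
  have e : (μ.tilted g).tilted (fun x => g' x - g x) = μ.tilted g' := by
    rw [tilted_tilted hg]; congr 1; ext x; simp
  have hexp : Integrable (fun x => Real.exp (g' x - g x)) (μ.tilted g) := by
    rw [integrable_tilted_iff hg]
    refine hg'.congr (ae_of_all _ fun x => ?_)
    simp [← Real.exp_add]
  simpa only [e] using klDiv_tilted_le_lintegral_add hexp

/-- In an exponential family with uniformly bounded potentials, the divergence from a member of the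
family attains its minimum over a compact set of parameters. -/
lemma exists_isLeast_klDiv_tilted {ι : Type*} [Fintype ι] {μ : Measure α} [IsProbabilityMeasure μ]
    {W : Set (ι → ℝ)} (hW : IsCompact W) (hne : W.Nonempty) {F : ι → α → ℝ}
    (hF : ∀ i, AEMeasurable (F i) μ) {v : ι → ℝ} {C : ℝ}
    (hv : ∀ᵐ x ∂μ, ∑ i, v i * F i x ≤ C) (hC : ∀ w ∈ W, ∀ᵐ x ∂μ, ∑ i, w i * F i x ≤ C) :
    ∃ m, IsLeast ((fun w => InformationTheory.klDiv (μ.tilted fun x => ∑ i, w i * F i x)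
      (μ.tilted fun x => ∑ i, v i * F i x)) '' W) m := by
  have hmeas : ∀ w : ι → ℝ, AEMeasurable (fun x => ∑ i, w i * F i x) μ := fun w =>
    Finset.aemeasurable_fun_sum _ fun i _ => (hF i).const_mul _
  have hint : ∀ w : ι → ℝ, (∀ᵐ x ∂μ, ∑ i, w i * F i x ≤ C) →
      Integrable (fun x => Real.exp (∑ i, w i * F i x)) μ := fun w hw =>
    Integrable.of_bound (Real.measurable_exp.comp_aemeasurable (hmeas w)).aestronglyMeasurable
      (Real.exp C) (hw.mono fun x hx => by simpa using hx)
  set G : (ι → ℝ) → α → ℝ := fun w x => ∑ i, w i * F i x with hG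
  set Z : (ι → ℝ) → ℝ := fun w => ∫ x, Real.exp (G w x) ∂μ with hZ
  have hZpos : ∀ w ∈ W, 0 < Z w := fun w hw => integral_exp_pos (hint w (hC w hw))
  have hGcont : ∀ x, Continuous fun w => G w x := fun x => by simp only [hG]; fun_prop
  have hZcont : ContinuousOn Z W := by
    refine continuousOn_of_dominated (bound := fun _ => Real.exp C)
      (fun w hw => (hint w (hC w hw)).1) (fun w hw => ?_) (integrable_const _)
      (ae_of_all _ fun x => ?_)
    · exact (hC w hw).mono fun x hx => by simpa using hx
    · exact (Real.continuous_exp.comp (hGcont x)).continuousOn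
  have hvint := hint v hv
  have := isProbabilityMeasure_tilted hvint
  set ν := μ.tilted (G v) with hν
  have hνμ : ν ≪ μ := tilted_absolutelyContinuous _ _
  have hkl : ∀ w ∈ W, InformationTheory.klDiv (μ.tilted (G w)) ν =
      ∫⁻ x, ENNReal.ofReal (InformationTheory.klFun (Real.exp (G w x - G v x) * (Z v / Z w))) ∂ν := by
    intro w hw
    have e : ν.tilted (fun x => G w x - G v x) = μ.tilted (G w) := by
      rw [hν, tilted_tilted hvint]; congr 1; ext x; simp [hG]
    have eZ : ∫ x, Real.exp (G w x - G v x) ∂ν = Z w / Z v := by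
      rw [hν, integral_exp_tilted]; simp [hZ]
    have hm : AEMeasurable (fun x => G w x - G v x) ν :=
      ((hmeas w).sub (hmeas v)).mono_ac hνμ
    rw [← e, InformationTheory.klDiv_eq_lintegral_klFun_of_ac (tilted_absolutelyContinuous _ _)]
    refine lintegral_congr_ae ?_
    filter_upwards [rnDeriv_tilted_left_self hm] with x hx
    rw [hx, eZ, ENNReal.toReal_ofReal (div_nonneg (Real.exp_pos _).le
      (div_nonneg (hZpos w hw).le (integral_exp_pos hvint).le)), div_eq_mul_inv, inv_div]
  have hlsc : LowerSemicontinuousOn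
      (fun w => InformationTheory.klDiv (μ.tilted (G w)) ν) W := by
    rw [lowerSemicontinuousOn_iff_le_liminf]
    intro w hw
    have hcongr : liminf (fun w => InformationTheory.klDiv (μ.tilted (G w)) ν) (𝓝[W] w) =
        liminf (fun w => ∫⁻ x, ENNReal.ofReal (InformationTheory.klFun
          (Real.exp (G w x - G v x) * (Z v / Z w))) ∂ν) (𝓝[W] w) :=
      liminf_congr (eventually_nhdsWithin_of_forall hkl)
    rw [hcongr, hkl w hw]
    -- The integrand is nonnegative and pointwise continuous in w, so Fatou gives lower
    -- semicontinuity even where the divergence is infinite.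
    refine le_trans (lintegral_mono fun x => ?_) (lintegral_liminf_le' fun w => ?_)
    · have : (𝓝[W] w).NeBot := mem_closure_iff_nhdsWithin_neBot.1 (subset_closure hw)
      refine le_of_eq (Tendsto.liminf_eq ?_).symm
      have h1 : ContinuousWithinAt (fun w => Real.exp (G w x - G v x) * (Z v / Z w)) W w :=
        ((Real.continuous_exp.comp ((hGcont x).sub continuous_const)).continuousWithinAt).mul
          (continuousWithinAt_const.div (hZcont w hw) (hZpos w hw).ne')
      exact (ENNReal.continuous_ofReal.tendsto _).comp
        ((InformationTheory.continuous_klFun.tendsto _).comp h1)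
    · refine ENNReal.measurable_ofReal.comp_aemeasurable
        (InformationTheory.continuous_klFun.measurable.comp_aemeasurable ?_)
      exact (Real.measurable_exp.comp_aemeasurable
        (((hmeas w).sub (hmeas v)).mono_ac hνμ)).mul_const _
  obtain ⟨w, hw, hmin⟩ := hlsc.exists_isMinOn hne hW
  exact ⟨_, ⟨w, hw, rfl⟩, by rintro _ ⟨w', hw', rfl⟩; exact hmin hw'⟩

end KullbackLeibler

/-! ### Global bounds from strong concavity. -/

section StrongConcavity

/-- A local upper bound at a point improves, for a strongly concave function, to a global one. -/
lemma StrongConcaveOn.sub_le_of_local {E : Type*} [NormedAddCommGroup E] [NormedSpace ℝ E]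
    {Θ : Set E} {m C B ε : ℝ} {g : E → ℝ} {θ₀ : E} (hg : StrongConcaveOn Θ m g) (hθ₀ : θ₀ ∈ Θ)
    (hε : 0 < ε)
    (hloc : ∀ θ ∈ Θ, ‖θ - θ₀‖ ≤ ε → g θ - g θ₀ ≤ C * ‖θ - θ₀‖ + B * ‖θ - θ₀‖ ^ 2) :
    ∀ θ ∈ Θ, g θ - g θ₀ ≤ C * ‖θ - θ₀‖ - m / 2 * ‖θ - θ₀‖ ^ 2 := by
  intro θ hθ
  set ρ := ‖θ - θ₀‖ with hρ
  have hρ0 : 0 ≤ ρ := norm_nonneg _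
  -- The local bound is used at the point a fraction t of the way from θ₀ to θ. After division by t,
  -- the local quadratic term carries a factor t and disappears as t → 0, while the full
  -- strong-concavity gain survives.
  have key : ∀ᶠ t : ℝ in 𝓝[>] 0,
      g θ - g θ₀ ≤ C * ρ + B * t * ρ ^ 2 - (1 - t) * (m / 2 * ρ ^ 2) := by
    have h1 : ∀ᶠ t : ℝ in 𝓝[>] 0, t * ρ < ε := by
      refine (Tendsto.mono_left ?_ nhdsWithin_le_nhds).eventually_lt_const hε
      have : Continuous fun t : ℝ => t * ρ := by fun_prop
      simpa using this.tendsto 0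
    have h2 : ∀ᶠ t : ℝ in 𝓝[>] 0, t < 1 :=
      Filter.Eventually.filter_mono nhdsWithin_le_nhds (eventually_lt_nhds zero_lt_one)
    filter_upwards [h1, h2, self_mem_nhdsWithin] with t ht1 ht2 ht0
    have ht0 : 0 < t := ht0
    have hc := hg.2 hθ hθ₀ ht0.le (sub_nonneg.2 ht2.le) (by ring)
    have hmem := hg.1 hθ hθ₀ ht0.le (sub_nonneg.2 ht2.le) (by ring)
    have e : t • θ + (1 - t) • θ₀ - θ₀ = t • (θ - θ₀) := by module
    have en : ‖t • θ + (1 - t) • θ₀ - θ₀‖ = t * ρ := by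
      rw [e, norm_smul, Real.norm_of_nonneg ht0.le]
    have hl := hloc _ hmem (by rw [en]; exact ht1.le)
    rw [en] at hl
    simp only [smul_eq_mul] at hc
    rw [← hρ] at hc
    have : t * (g θ - g θ₀) ≤ t * (C * ρ + B * t * ρ ^ 2 - (1 - t) * (m / 2 * ρ ^ 2)) := by
      nlinarith
    exact le_of_mul_le_mul_left this ht0
  have hlim : Tendsto (fun t : ℝ => C * ρ + B * t * ρ ^ 2 - (1 - t) * (m / 2 * ρ ^ 2)) (𝓝[>] 0)
      (𝓝 (C * ρ - m / 2 * ρ ^ 2)) := by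
    refine Tendsto.mono_left ?_ nhdsWithin_le_nhds
    have : Continuous fun t : ℝ => C * ρ + B * t * ρ ^ 2 - (1 - t) * (m / 2 * ρ ^ 2) := by fun_prop
    simpa using this.tendsto 0
  exact ge_of_tendsto hlim key

/-- Differentiability at one point bounds the increments linearly near it; strong concavity extends
this bound with a negative quadratic term, whose maximum is finite. -/
lemma StrongConcaveOn.bddAbove_of_differentiableWithinAt {E : Type*} [NormedAddCommGroup E]
    [NormedSpace ℝ E] {Θ : Set E} {m : ℝ} {g : E → ℝ} {θ₀ : E} (hm : 0 < m)
    (hg : StrongConcaveOn Θ m g) (hθ₀ : θ₀ ∈ Θ) (hd : DifferentiableWithinAt ℝ g Θ θ₀) :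
    ∃ C, ∀ θ ∈ Θ, g θ ≤ C := by
  obtain ⟨C, hC⟩ := hd.isBigO_sub.bound
  rw [Filter.Eventually, Metric.mem_nhdsWithin_iff] at hC
  obtain ⟨ε, hε, hC⟩ := hC
  have h := hg.sub_le_of_local (C := C) (B := 0) hθ₀ (half_pos hε) (fun θ hθ hle => by
    have := hC ⟨mem_ball_iff_norm.2 (by linarith), hθ⟩
    simp only [Set.mem_ofPred_eq, Real.norm_eq_abs] at this
    linarith [le_abs_self (g θ - g θ₀)])
  refine ⟨g θ₀ + C ^ 2 / (2 * m), fun θ hθ => ?_⟩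
  have h1 := h θ hθ
  have h2 : C * ‖θ - θ₀‖ - m / 2 * ‖θ - θ₀‖ ^ 2 ≤ C ^ 2 / (2 * m) := by
    rw [le_div_iff₀ (by positivity)]
    nlinarith [sq_nonneg (C - m * ‖θ - θ₀‖)]
  linarith

lemma StrongConcaveOn.sum_smul_sub_const {E ι : Type*} [NormedAddCommGroup E] [NormedSpace ℝ E]
    [Fintype ι] {Θ : Set E} {m : ℝ} {F : ι → E → ℝ} (hΘ : Convex ℝ Θ)
    (hF : ∀ i, StrongConcaveOn Θ m (F i)) {v : ι → ℝ} (hv : ∀ i, 0 ≤ v i) (c : ι → ℝ) :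
    StrongConcaveOn Θ ((∑ i, v i) * m) (fun θ => ∑ i, v i * (F i θ - c i)) := by
  refine ⟨hΘ, fun x hx y hy a b ha hb hab => ?_⟩
  simp only [smul_eq_mul, Finset.mul_sum, Finset.sum_mul, Finset.sum_div, ← Finset.sum_add_distrib]
  refine Finset.sum_le_sum fun i _ => ?_
  have h := (hF i).2 hx hy ha hb hab
  simp only [smul_eq_mul] at h
  have h2 := mul_le_mul_of_nonneg_left h (hv i)
  have h3 : v i * c i = v i * (a * c i + b * c i) := by rw [← add_mul, hab, one_mul]
  linear_combination h2 + h3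

end StrongConcavity

/-! ### Volume near θ₀ and Gaussian integrals. -/

section Volume

variable {D : ℕ}

/-- θ₀ may lie on the boundary of Θ, so Θ need not contain a ball around it. By convexity, shrinking
a bounded piece of Θ of positive volume towards θ₀ by the factor t stays in Θ and scales the volume
by t^D. -/
lemma exists_volume_inter_closedBall_ge {Θ : Set (EuclideanSpace ℝ (Fin D))} (hΘ : Convex ℝ Θ)
    (hpos : volume Θ ≠ 0) {θ₀ : EuclideanSpace ℝ (Fin D)} (hθ₀ : θ₀ ∈ Θ) :
    ∃ r V : ℝ, 0 < r ∧ 0 < V ∧ ∀ t ∈ Set.Ioc (0 : ℝ) 1,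
      ENNReal.ofReal (V * t ^ D) ≤ volume (Θ ∩ Metric.closedBall θ₀ (t * r)) := by
  obtain ⟨n, hn⟩ : ∃ n : ℕ, volume (Θ ∩ Metric.closedBall θ₀ (n + 1)) ≠ 0 := by
    by_contra! h
    refine hpos (measure_mono_null (fun θ hθ => ?_) (measure_iUnion_null h))
    obtain ⟨n, hn⟩ := exists_nat_ge ‖θ - θ₀‖
    exact Set.mem_iUnion.2 ⟨n, hθ, mem_closedBall_iff_norm.2 (by linarith)⟩
  set A := Θ ∩ Metric.closedBall θ₀ (n + 1) with hA
  have hfin : volume A ≠ ∞ :=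
    ((measure_mono Set.inter_subset_right).trans_lt measure_closedBall_lt_top).ne
  refine ⟨n + 1, (volume A).toReal, by positivity, ENNReal.toReal_pos hn hfin, fun t ht => ?_⟩
  have himg : AffineMap.homothety θ₀ t '' A ⊆ Θ ∩ Metric.closedBall θ₀ (t * (n + 1)) := by
    rintro _ ⟨θ, ⟨hθ, hb⟩, rfl⟩
    rw [mem_closedBall_iff_norm] at hb
    refine ⟨?_, ?_⟩
    · rw [AffineMap.homothety_apply]
      have := hΘ hθ hθ₀ ht.1.le (sub_nonneg.2 ht.2) (by ring)
      convert this using 1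
      simp only [vsub_eq_sub, vadd_eq_add]; module
    · rw [mem_closedBall_iff_norm, AffineMap.homothety_apply]
      simp only [vsub_eq_sub, vadd_eq_add, add_sub_cancel_right, norm_smul,
        Real.norm_of_nonneg ht.1.le]
      exact mul_le_mul_of_nonneg_left hb ht.1.le
  refine le_trans (le_of_eq ?_) (measure_mono himg)
  rw [Measure.addHaar_image_homothety, finrank_euclideanSpace_fin,
    abs_of_nonneg (pow_nonneg ht.1.le _), mul_comm, ENNReal.ofReal_mul (pow_nonneg ht.1.le _),
    ENNReal.ofReal_toReal hfin]

lemma lintegral_comp_smul_sub {f : EuclideanSpace ℝ (Fin D) → ℝ≥0∞} (hf : Measurable f)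
    (θ₀ : EuclideanSpace ℝ (Fin D)) {s : ℝ} (hs : 0 < s) :
    ∫⁻ θ, f (s • (θ - θ₀)) = ENNReal.ofReal (s⁻¹ ^ D) * ∫⁻ u, f u := by
  rw [lintegral_sub_right_eq_self (fun θ => f (s • θ)) θ₀,
    ← lintegral_map (f := f) hf (measurable_const_smul s), Measure.map_addHaar_smul _ hs.ne',
    lintegral_smul_measure, finrank_euclideanSpace_fin, abs_of_nonneg (by positivity), inv_pow,
    smul_eq_mul]

lemma lintegral_sq_mul_exp_lt_top {a l : ℝ} (hl : 0 < l) :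
    ∫⁻ u : EuclideanSpace ℝ (Fin D),
      ENNReal.ofReal (‖u‖ ^ 2 * Real.exp (a * ‖u‖ - l / 2 * ‖u‖ ^ 2)) < ∞ := by
  have hgauss : Integrable fun u : EuclideanSpace ℝ (Fin D) => Real.exp (-(l / 4) * ‖u‖ ^ 2) := by
    have h := (GaussianFourier.integrable_cexp_neg_mul_sq_norm_add
      (V := EuclideanSpace ℝ (Fin D)) (b := ((l / 4 : ℝ) : ℂ)) (by simpa using hl) 0 0).norm
    refine h.congr (ae_of_all _ fun u => ?_)
    simp only [zero_mul, add_zero, Complex.norm_exp]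
    congr 1
    norm_cast
  refine lt_of_le_of_lt (lintegral_mono fun u => ENNReal.ofReal_le_ofReal ?_)
    (hgauss.const_mul (8 / l * Real.exp (2 * a ^ 2 / l))).lintegral_lt_top
  -- Of the Gaussian rate l/2, one part l/8 absorbs the factor ‖u‖², another l/8 the linear term,
  -- and l/4 is left for integrability.
  have h1 : ‖u‖ ^ 2 ≤ 8 / l * Real.exp (l / 8 * ‖u‖ ^ 2) := by
    have := Real.add_one_le_exp (l / 8 * ‖u‖ ^ 2)
    calc ‖u‖ ^ 2 = 8 / l * (l / 8 * ‖u‖ ^ 2) := by field_simp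
      _ ≤ _ := by gcongr; linarith
  calc ‖u‖ ^ 2 * Real.exp (a * ‖u‖ - l / 2 * ‖u‖ ^ 2)
      ≤ 8 / l * Real.exp (l / 8 * ‖u‖ ^ 2) * Real.exp (a * ‖u‖ - l / 2 * ‖u‖ ^ 2) := by gcongr
    _ = 8 / l * Real.exp (l / 8 * ‖u‖ ^ 2 + (a * ‖u‖ - l / 2 * ‖u‖ ^ 2)) := by
        rw [mul_assoc, ← Real.exp_add]
    _ ≤ 8 / l * Real.exp (2 * a ^ 2 / l + -(l / 4) * ‖u‖ ^ 2) := by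
        refine mul_le_mul_of_nonneg_left (Real.exp_le_exp.2 ?_) (by positivity)
        have : a * ‖u‖ - l / 8 * ‖u‖ ^ 2 ≤ 2 * a ^ 2 / l := by
          rw [le_div_iff₀ hl]; nlinarith [sq_nonneg (4 * a - l * ‖u‖)]
        linarith
    _ = _ := by rw [Real.exp_add]; ring

end Volume

/-! ### Laplace-type concentration at scale 1/√N. -/

section Laplace

variable {D : ℕ}

/-- The curvature N L₀/2 is split: N L₀/8 absorbs the linear term, N L₀/4 absorbs K, and N L₀/8 is
kept as decay. -/
lemma eventually_tail_exponent_le {a L₀ K ε : ℝ} (hL₀ : 0 < L₀) (hε : 0 < ε) :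
    ∀ᶠ N : ℕ in atTop, ∀ ρ : ℝ, ε ≤ ρ →
      a * √N * ρ - N * L₀ / 2 * ρ ^ 2 + K * ρ ^ 2 ≤ -(L₀ * ε ^ 2 / 8 * N) := by
  have h1 : ∀ᶠ N : ℕ in atTop, K ≤ N * L₀ / 4 := by
    filter_upwards [eventually_ge_atTop ⌈4 * K / L₀⌉₊] with N hN
    have := Nat.ceil_le.1 hN
    rw [div_le_iff₀ hL₀] at this
    linarith
  have h2 : ∀ᶠ N : ℕ in atTop, a * 8 / (L₀ * ε) ≤ √N :=
    (Real.tendsto_sqrt_atTop.comp tendsto_natCast_atTop_atTop).eventually_ge_atTop _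
  filter_upwards [h1, h2] with N h1 h2 ρ hρ
  have hρ0 : 0 < ρ := hε.trans_le hρ
  rw [div_le_iff₀ (by positivity)] at h2
  have hN : √(N : ℝ) ^ 2 = N := Real.sq_sqrt (Nat.cast_nonneg N)
  have h3 : a * √N * ρ ≤ N * L₀ / 8 * ρ ^ 2 := by
    have : a * 8 ≤ √N * (L₀ * ρ) := h2.trans (by gcongr)
    have h4 := mul_le_mul_of_nonneg_left this (show 0 ≤ √(N : ℝ) * ρ by positivity)
    have h5 : √(N : ℝ) * ρ * (√N * (L₀ * ρ)) = N * L₀ * ρ ^ 2 := by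
      linear_combination L₀ * ρ ^ 2 * hN
    nlinarith
  have h6 : K * ρ ^ 2 ≤ N * L₀ / 4 * ρ ^ 2 := by gcongr
  have h7 : N * L₀ / 8 * ε ^ 2 ≤ N * L₀ / 8 * ρ ^ 2 := by gcongr
  linarith

lemma eventually_pow_mul_exp_neg_le (k : ℕ) {κ τ : ℝ} (hκ : 0 < κ) (hτ : 0 < τ) :
    ∀ᶠ N : ℕ in atTop, (N : ℝ) ^ k * Real.exp (-(κ * N)) ≤ τ := by
  have h := (Real.tendsto_pow_mul_exp_neg_atTop_nhds_zero k).comp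
    (tendsto_natCast_atTop_atTop.const_mul_atTop hκ)
  have h2 := h.eventually_le_const (show (0 : ℝ) < τ * κ ^ k by positivity)
  filter_upwards [h2] with N hN
  simp only [Function.comp_apply, mul_pow] at hN
  have : κ ^ k * ((N : ℝ) ^ k * Real.exp (-(κ * N))) ≤ κ ^ k * τ := by linarith
  exact le_of_mul_le_mul_left this (by positivity)

/-- Laplace-type bound: under the Gibbs measure of a potential that is `N L₀`-strongly concave and
of order `√N ρ + N ρ²` at distance `ρ` from `θ₀`, a function that is at most `τ N ρ²` near `θ₀`
and has a polynomially large Gaussian moment has a mean of order `τ`. -/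
lemma exists_lintegral_tilted_le {Θ : Set (EuclideanSpace ℝ (Fin D))} (hΘm : MeasurableSet Θ)
    (hΘ : Convex ℝ Θ) {θ₀ : EuclideanSpace ℝ (Fin D)} (hθ₀ : θ₀ ∈ Θ)
    {π₀ : EuclideanSpace ℝ (Fin D) → ℝ} (hπm : Measurable π₀)
    (hπ1 : IsProbabilityMeasure ((volume.restrict Θ).withDensity fun θ => ENNReal.ofReal (π₀ θ)))
    {ε₀ c B L₀ K a b : ℝ} (hc : 0 < c) (hlow : ∀ θ ∈ Θ, ‖θ - θ₀‖ ≤ ε₀ → c ≤ π₀ θ)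
    (hB : ∀ θ ∈ Θ, π₀ θ ≤ B) (hε₀ : 0 < ε₀) (hL₀ : 0 < L₀)
    (ha : 0 ≤ a) (hb : 0 ≤ b) :
    ∃ C : ℝ, 0 < C ∧ ∀ ε ∈ Set.Ioc 0 ε₀, ∀ τ : ℝ, 0 < τ → ∀ᶠ N : ℕ in atTop,
      ∀ g h : EuclideanSpace ℝ (Fin D) → ℝ, AEMeasurable g (volume.restrict Θ) →
        StrongConcaveOn Θ (N * L₀) g → g θ₀ = 0 →
        (∀ θ ∈ Θ, ‖θ - θ₀‖ ≤ ε → |g θ| ≤ a * √N * ‖θ - θ₀‖ + b * N * ‖θ - θ₀‖ ^ 2) →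
        (∀ θ ∈ Θ, ‖θ - θ₀‖ ≤ ε → |h θ| ≤ τ * N * ‖θ - θ₀‖ ^ 2) →
        ∫⁻ θ, ‖h θ‖ₑ * ENNReal.ofReal (Real.exp (-K * ‖θ - θ₀‖ ^ 2))
          ∂((volume.restrict Θ).withDensity fun θ => ENNReal.ofReal (π₀ θ)) ≤
            ENNReal.ofReal ((N : ℝ) ^ 4) →
        Integrable (fun θ => Real.exp (g θ))
          ((volume.restrict Θ).withDensity fun θ => ENNReal.ofReal (π₀ θ)) ∧
        ∫⁻ θ, ‖h θ‖ₑ ∂(((volume.restrict Θ).withDensity fun θ => ENNReal.ofReal (π₀ θ)).tilted g) ≤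
          ENNReal.ofReal (C * τ) := by
  set μ := (volume.restrict Θ).withDensity fun θ => ENNReal.ofReal (π₀ θ) with hμ
  have hμac : μ ≪ volume.restrict Θ := withDensity_absolutelyContinuous _ _
  have hμΘ : ∀ᵐ θ ∂μ, θ ∈ Θ := hμac.ae_le (ae_restrict_mem hΘm)
  have hwd : ∀ F : EuclideanSpace ℝ (Fin D) → ℝ≥0∞,
      ∫⁻ θ, F θ ∂μ = ∫⁻ θ in Θ, ENNReal.ofReal (π₀ θ) * F θ := fun F =>
    lintegral_withDensity_eq_lintegral_mul_non_measurable _ hπm.ennreal_ofReal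
      (ae_of_all _ fun _ => ENNReal.ofReal_lt_top) F
  have hpos : volume Θ ≠ 0 := fun h0 => by
    have : μ = 0 := by rw [hμ, Measure.restrict_eq_zero.2 h0]; simp
    exact (IsProbabilityMeasure.ne_zero μ) this
  have hBpos : 0 < B := hc.trans_le ((hlow θ₀ hθ₀ (by simpa using hε₀.le)).trans (hB θ₀ hθ₀))
  obtain ⟨r, V, hr, hV, hvol⟩ := exists_volume_inter_closedBall_ge hΘ hpos hθ₀
  set G : EuclideanSpace ℝ (Fin D) → ℝ≥0∞ := fun u =>
    ENNReal.ofReal (‖u‖ ^ 2 * Real.exp (a * ‖u‖ - L₀ / 2 * ‖u‖ ^ 2)) with hG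
  have hGm : Measurable G := by
    simp only [hG]; exact Measurable.ennreal_ofReal (by fun_prop)
  set I : ℝ := (∫⁻ u, G u).toReal with hI
  have hIG : ENNReal.ofReal I = ∫⁻ u, G u :=
    ENNReal.ofReal_toReal (lintegral_sq_mul_exp_lt_top hL₀).ne
  have hI0 : 0 ≤ I := ENNReal.toReal_nonneg
  -- On the ball of radius r/√N the exponent is at least -(a r + b r²), so the normalizer is at
  -- least c₁ N^(-D/2).
  set c₁ : ℝ := c * Real.exp (-(a * r + b * r ^ 2)) * V with hc₁
  have hc₁pos : 0 < c₁ := by positivity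
  -- The first summand serves the region near θ₀, where the powers N^(-D/2) of integral and
  -- normalizer cancel; the 1 pays for the tail. The constant does not involve ε or τ, so τ can
  -- later be chosen in terms of it.
  refine ⟨B * I / c₁ + 1, by positivity, fun ε hε τ hτ => ?_⟩
  have hev1 : ∀ᶠ N : ℕ in atTop, r / ε ≤ √N :=
    (Real.tendsto_sqrt_atTop.comp tendsto_natCast_atTop_atTop).eventually_ge_atTop _
  have hκ : 0 < L₀ * ε ^ 2 / 8 := by have := hε.1; positivity
  filter_upwards [hev1, eventually_ge_atTop 1, eventually_tail_exponent_le (a := a) (K := K) hL₀ hε.1,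
    eventually_pow_mul_exp_neg_le (4 + D) hκ (mul_pos hτ hc₁pos)]
    with N hN1 hN hNtail hNexp g h hgm hg hg0 hgloc hhloc hfar
  have hN' : (1 : ℝ) ≤ N := by exact_mod_cast hN
  have hs : 0 < √(N : ℝ) := Real.sqrt_pos.2 (by linarith)
  have hs1 : 1 ≤ √(N : ℝ) := Real.one_le_sqrt.2 hN'
  have hs2 : √(N : ℝ) ^ 2 = N := Real.sq_sqrt (by linarith)
  have hup : ∀ θ ∈ Θ, g θ ≤ a * √N * ‖θ - θ₀‖ - N * L₀ / 2 * ‖θ - θ₀‖ ^ 2 := fun θ hθ => by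
    have := hg.sub_le_of_local (C := a * √N) (B := b * N) hθ₀ hε.1 (fun θ hθ hle => by
      rw [hg0, sub_zero]; exact (le_abs_self _).trans (hgloc θ hθ hle)) θ hθ
    rwa [hg0, sub_zero] at this
  have hint : Integrable (fun θ => Real.exp (g θ)) μ := by
    refine Integrable.of_bound (Real.measurable_exp.comp_aemeasurable
      (hgm.mono_ac hμac)).aestronglyMeasurable (Real.exp (a ^ 2 / (2 * L₀))) ?_
    filter_upwards [hμΘ] with θ hθ
    rw [Real.norm_of_nonneg (Real.exp_pos _).le, Real.exp_le_exp]
    refine (hup θ hθ).trans ?_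
    rw [le_div_iff₀ (by positivity)]
    have : (√(N : ℝ) * ‖θ - θ₀‖) ^ 2 = N * ‖θ - θ₀‖ ^ 2 := by rw [mul_pow, hs2]
    linear_combination sq_nonneg (a - L₀ * (√N * ‖θ - θ₀‖)) + L₀ ^ 2 * this
  refine ⟨hint, ?_⟩
  set Z : ℝ := ∫ θ, Real.exp (g θ) ∂μ with hZ
  have hZlow : c₁ * (√N)⁻¹ ^ D ≤ Z := by
    have ht : (√(N : ℝ))⁻¹ ∈ Set.Ioc (0 : ℝ) 1 := ⟨by positivity, inv_le_one_of_one_le₀ hs1⟩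
    rw [← ENNReal.ofReal_le_ofReal_iff (integral_nonneg fun _ => (Real.exp_pos _).le),
      ofReal_integral_eq_lintegral_ofReal hint (ae_of_all _ fun _ => (Real.exp_pos _).le), hwd]
    set A := Θ ∩ Metric.closedBall θ₀ ((√(N : ℝ))⁻¹ * r) with hA
    have hAm : MeasurableSet A := hΘm.inter measurableSet_closedBall
    calc ENNReal.ofReal (c₁ * (√N)⁻¹ ^ D)
        = ENNReal.ofReal (c * Real.exp (-(a * r + b * r ^ 2))) *
            ENNReal.ofReal (V * (√N)⁻¹ ^ D) := by
          rw [← ENNReal.ofReal_mul (by positivity), hc₁]; ring_nf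
      _ ≤ ENNReal.ofReal (c * Real.exp (-(a * r + b * r ^ 2))) * volume A :=
          mul_le_mul_right (hvol _ ht) _
      _ = ∫⁻ _ in A, ENNReal.ofReal (c * Real.exp (-(a * r + b * r ^ 2))) := by
          rw [setLIntegral_const]
      _ ≤ ∫⁻ θ in A, ENNReal.ofReal (π₀ θ) * ENNReal.ofReal (Real.exp (g θ)) := by
          refine setLIntegral_mono_ae' hAm (ae_of_all _ fun θ hθ => ?_)
          have hd := mem_closedBall_iff_norm.1 hθ.2
          have hdε : ‖θ - θ₀‖ ≤ ε := hd.trans (by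
            rw [div_le_iff₀ hε.1] at hN1
            rw [inv_mul_le_iff₀ hs]; exact hN1)
          have hd' : √N * ‖θ - θ₀‖ ≤ r := by
            rwa [inv_mul_eq_div, le_div_iff₀' hs] at hd
          have hcπ := hlow θ hθ.1 (hdε.trans hε.2)
          rw [← ENNReal.ofReal_mul (hc.le.trans hcπ)]
          refine ENNReal.ofReal_le_ofReal (mul_le_mul hcπ (Real.exp_le_exp.2 ?_)
            (Real.exp_pos _).le (hc.le.trans hcπ))
          have h1 := (abs_le.1 (hgloc θ hθ.1 hdε)).1
          have h2 : a * (√N * ‖θ - θ₀‖) ≤ a * r := by gcongr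
          have h3 : b * (√N * ‖θ - θ₀‖) ^ 2 ≤ b * r ^ 2 := by gcongr
          rw [mul_pow, hs2] at h3
          linarith
      _ ≤ _ := lintegral_mono_set Set.inter_subset_left
  have hZpos : 0 < Z := integral_exp_pos hint
  rw [lintegral_tilted]
  -- Within ε, rescaling by √N turns the bound into τ times a fixed Gaussian-type function. Beyond
  -- ε, the decay of exp g supplies both an exponentially small factor and the weight exp(-K ‖θ -
  -- θ₀‖²).
  have hsplit : ∀ᵐ θ ∂μ, ENNReal.ofReal (Real.exp (g θ) / Z) * ‖h θ‖ₑ ≤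
      ENNReal.ofReal (τ / Z) * G (√N • (θ - θ₀)) +
      ENNReal.ofReal (Real.exp (-(L₀ * ε ^ 2 / 8 * N)) / Z) *
        (‖h θ‖ₑ * ENNReal.ofReal (Real.exp (-K * ‖θ - θ₀‖ ^ 2))) := by
    filter_upwards [hμΘ] with θ hθ
    rcases le_total ‖θ - θ₀‖ ε with hle | hle
    · refine le_trans ?_ le_self_add
      rw [hG, ← ENNReal.ofReal_mul (by positivity), ← ofReal_norm,
        ← ENNReal.ofReal_mul (by positivity)]
      refine ENNReal.ofReal_le_ofReal ?_
      rw [norm_smul, Real.norm_of_nonneg hs.le, mul_pow, hs2]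
      have h1 := hhloc θ hθ hle
      have h2 := Real.exp_le_exp.2 (hup θ hθ)
      have h3 : a * √N * ‖θ - θ₀‖ - N * L₀ / 2 * ‖θ - θ₀‖ ^ 2 =
        a * (√N * ‖θ - θ₀‖) - L₀ / 2 * (N * ‖θ - θ₀‖ ^ 2) := by ring
      rw [h3] at h2
      calc Real.exp (g θ) / Z * ‖h θ‖
          ≤ Real.exp (a * (√N * ‖θ - θ₀‖) - L₀ / 2 * (N * ‖θ - θ₀‖ ^ 2)) / Z *
              (τ * N * ‖θ - θ₀‖ ^ 2) := by gcongr; exact h1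
        _ = _ := by ring
    · refine le_trans ?_ le_add_self
      rw [mul_comm (‖h θ‖ₑ), ← mul_assoc, ← ENNReal.ofReal_mul (by positivity)]
      refine mul_le_mul_left (ENNReal.ofReal_le_ofReal ?_) _
      rw [div_mul_eq_mul_div, ← Real.exp_add]
      gcongr
      linarith [hup θ hθ, hNtail _ hle]
  have hnear : ∫⁻ θ, G (√N • (θ - θ₀)) ∂μ ≤ ENNReal.ofReal (B * I * (√N)⁻¹ ^ D) := by
    rw [hwd]
    calc ∫⁻ θ in Θ, ENNReal.ofReal (π₀ θ) * G (√N • (θ - θ₀))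
        ≤ ∫⁻ θ in Θ, ENNReal.ofReal B * G (√N • (θ - θ₀)) :=
          setLIntegral_mono_ae' hΘm (ae_of_all _ fun θ hθ =>
            mul_le_mul_left (ENNReal.ofReal_le_ofReal (hB θ hθ)) _)
      _ ≤ ∫⁻ θ, ENNReal.ofReal B * G (√N • (θ - θ₀)) := setLIntegral_le_lintegral _ _
      _ = ENNReal.ofReal (B * I * (√N)⁻¹ ^ D) := by
          rw [lintegral_const_mul' _ _ ENNReal.ofReal_ne_top, lintegral_comp_smul_sub hGm θ₀ hs,
            ← hIG, ← ENNReal.ofReal_mul (by positivity), ← ENNReal.ofReal_mul hBpos.le]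
          ring_nf
  have hGm' : Measurable fun θ => G (√N • (θ - θ₀)) :=
    hGm.comp (by fun_prop)
  calc ∫⁻ θ, ENNReal.ofReal (Real.exp (g θ) / Z) * ‖h θ‖ₑ ∂μ
      ≤ ENNReal.ofReal (τ / Z) * ∫⁻ θ, G (√N • (θ - θ₀)) ∂μ +
        ENNReal.ofReal (Real.exp (-(L₀ * ε ^ 2 / 8 * N)) / Z) *
        ∫⁻ θ, (‖h θ‖ₑ * ENNReal.ofReal (Real.exp (-K * ‖θ - θ₀‖ ^ 2))) ∂μ := by
        refine (lintegral_mono_ae hsplit).trans (le_of_eq ?_)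
        rw [lintegral_add_left (hGm'.const_mul _), lintegral_const_mul' _ _ ENNReal.ofReal_ne_top,
          lintegral_const_mul' _ _ ENNReal.ofReal_ne_top]
    _ ≤ ENNReal.ofReal (τ / Z) * ENNReal.ofReal (B * I * (√N)⁻¹ ^ D) +
        ENNReal.ofReal (Real.exp (-(L₀ * ε ^ 2 / 8 * N)) / Z) * ENNReal.ofReal ((N : ℝ) ^ 4) := by
        gcongr
    _ = ENNReal.ofReal (τ / Z * (B * I * (√N)⁻¹ ^ D) +
        Real.exp (-(L₀ * ε ^ 2 / 8 * N)) / Z * (N : ℝ) ^ 4) := by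
        rw [← ENNReal.ofReal_mul (by positivity), ← ENNReal.ofReal_mul (by positivity),
          ← ENNReal.ofReal_add (by positivity) (by positivity)]
    _ ≤ ENNReal.ofReal ((B * I / c₁ + 1) * τ) := by
        refine ENNReal.ofReal_le_ofReal ?_
        have hp : 0 < (√(N : ℝ))⁻¹ ^ D := by positivity
        have e1 : τ / Z * (B * I * (√N)⁻¹ ^ D) ≤ B * I / c₁ * τ := by
          calc τ / Z * (B * I * (√N)⁻¹ ^ D)
              ≤ τ / (c₁ * (√N)⁻¹ ^ D) * (B * I * (√N)⁻¹ ^ D) := by gcongr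
            _ = B * I / c₁ * τ := by field_simp
        have e2 : Real.exp (-(L₀ * ε ^ 2 / 8 * N)) / Z * (N : ℝ) ^ 4 ≤ τ := by
          calc Real.exp (-(L₀ * ε ^ 2 / 8 * N)) / Z * (N : ℝ) ^ 4
              ≤ Real.exp (-(L₀ * ε ^ 2 / 8 * N)) / (c₁ * (√N)⁻¹ ^ D) * (N : ℝ) ^ 4 := by gcongr
            _ = (N : ℝ) ^ 4 * √N ^ D * Real.exp (-(L₀ * ε ^ 2 / 8 * N)) / c₁ := by
                rw [inv_pow]; field_simp
            _ ≤ (N : ℝ) ^ 4 * (N : ℝ) ^ D * Real.exp (-(L₀ * ε ^ 2 / 8 * N)) / c₁ := by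
                gcongr
                exact (Real.sqrt_le_left (by positivity)).2 (by nlinarith)
            _ ≤ τ := by
                rw [div_le_iff₀ hc₁pos, ← pow_add]; exact hNexp
        linarith

end Laplace

/-! ### White vectors spanning the finite-dimensional part. -/

section Whitening

/-- Point evaluations lie in the finite-dimensional dual of V, so finitely many of them span all the
others. Using evaluations as coordinates, rather than an arbitrary basis, keeps the coordinates
measurable and square-integrable in the data later. -/
lemma exists_evaluation_expansion {T : Type*} (V : Submodule ℝ (T → ℝ)) [FiniteDimensional ℝ V] :
    ∃ (d : ℕ) (t : Fin d → T) (a : T → Fin d → ℝ),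
      ∀ v ∈ V, ∀ s, v s = ∑ i, a s i * v (t i) := by
  set ev : T → Module.Dual ℝ V := fun s => (LinearMap.proj s).comp V.subtype with hev
  obtain ⟨F, hF, hspan, -⟩ := Submodule.exists_fun_fin_finrank_span_eq ℝ (Set.range ev)
  choose t ht using hF
  have h : ∀ s, ∃ c : Fin _ → ℝ, ∑ i, c i • F i = ev s := fun s => by
    rw [← Submodule.mem_span_range_iff_exists_fun, hspan]
    exact Submodule.subset_span ⟨s, rfl⟩
  choose a ha using h
  refine ⟨_, t, a, fun v hv s => ?_⟩
  have := congrArg (fun φ => φ ⟨v, hv⟩) (ha s)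
  simp only [← ht, hev] at this
  simpa using this.symm

variable {𝒳 : Type*} [MeasurableSpace 𝒳]

/-- A random vector is white if it is square-integrable and centered and its covariance is the
identity. -/
structure IsWhite (p : Measure 𝒳) {k : ℕ} (e : 𝒳 → EuclideanSpace ℝ (Fin k)) : Prop where
  measurable : Measurable e
  memLp : ∀ u, MemLp (fun x => inner ℝ u (e x)) 2 p
  integral_eq_zero : ∀ u, ∫ x, inner ℝ u (e x) ∂p = 0
  integral_sq : ∀ u, ∫ x, (inner ℝ u (e x)) ^ 2 ∂p = ‖u‖ ^ 2

lemma Lp_coeFn_sum {p : Measure 𝒳} {ι : Type*} (s : Finset ι) (F : ι → Lp ℝ 2 p) :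
    ⇑(∑ i ∈ s, F i) =ᵐ[p] fun x => ∑ i ∈ s, F i x := by
  classical
  induction s using Finset.induction_on with
  | empty =>
    filter_upwards [Lp.coeFn_zero ℝ 2 p] with x hx
    simpa using hx
  | insert i s hi ih =>
    rw [Finset.sum_insert hi]
    filter_upwards [Lp.coeFn_add (F i) (∑ i ∈ s, F i), ih] with x h1 h2
    rw [h1, Pi.add_apply, h2, Finset.sum_insert hi]

/-- Finitely many square-integrable random variables are affine functions of a white random
vector. -/
lemma exists_isWhite {p : Measure 𝒳} [IsProbabilityMeasure p] {ι : Type*} [Finite ι]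
    {ψ : ι → 𝒳 → ℝ} (hψ : ∀ i, MemLp (ψ i) 2 p) :
    ∃ (k : ℕ) (e : 𝒳 → EuclideanSpace ℝ (Fin k)) (c : ι → EuclideanSpace ℝ (Fin k)),
      IsWhite p e ∧ ∀ i, ∀ᵐ x ∂p, ψ i x = ∫ y, ψ i y ∂p + inner ℝ (c i) (e x) := by
  set Y : ι → Lp ℝ 2 p := fun i => ((hψ i).sub (memLp_const (∫ y, ψ i y ∂p))).toLp _ with hY
  have hYae : ∀ i, Y i =ᵐ[p] fun x => ψ i x - ∫ y, ψ i y ∂p := fun i => MemLp.coeFn_toLp _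
  set H : Submodule ℝ (Lp ℝ 2 p) := Submodule.span ℝ (Set.range Y) with hH
  have : FiniteDimensional ℝ H := FiniteDimensional.span_of_finite ℝ (Set.finite_range Y)
  have hmean : ∀ z ∈ H, ∫ x, z x ∂p = 0 := by
    intro z hz
    induction hz using Submodule.span_induction with
    | mem z hz =>
      obtain ⟨i, rfl⟩ := hz
      rw [integral_congr_ae (hYae i), integral_sub ((hψ i).integrable one_le_two)
        (integrable_const _)]
      simp
    | zero => rw [integral_congr_ae (Lp.coeFn_zero ℝ 2 p)]; simp
    | add z z' _ _ h1 h2 =>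
      rw [integral_congr_ae (Lp.coeFn_add z z')]
      simp only [Pi.add_apply]
      rw [integral_add ((Lp.memLp z).integrable one_le_two) ((Lp.memLp z').integrable one_le_two),
        h1, h2, add_zero]
    | smul r z _ h1 =>
      rw [integral_congr_ae (Lp.coeFn_smul r z)]
      simp only [Pi.smul_apply]
      rw [integral_smul, h1, smul_zero]
  -- An orthonormal basis of the span of the centered variables in L² discards linear dependencies,
  -- so the covariance is exactly the identity; centering holds because every element of the span
  -- has mean zero.
  set b := stdOrthonormalBasis ℝ H with hb
  set e : 𝒳 → EuclideanSpace ℝ (Fin (Module.finrank ℝ H)) :=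
    fun x => WithLp.toLp 2 fun j => (b j : Lp ℝ 2 p) x with he
  have heT : ∀ u, ∀ᵐ x ∂p, inner ℝ u (e x) = (b.repr.symm u : Lp ℝ 2 p) x := by
    intro u
    rw [← b.sum_repr_symm, Submodule.coe_sum]
    have h1 : ∀ᵐ x ∂p, ∀ j, (u j • (b j : Lp ℝ 2 p)) x = u j * (b j : Lp ℝ 2 p) x := by
      rw [ae_all_iff]
      intro j
      filter_upwards [Lp.coeFn_smul (u j) (b j : Lp ℝ 2 p)] with x hx
      rw [hx]; simp
    filter_upwards [Lp_coeFn_sum Finset.univ fun j => ((u j • b j : H) : Lp ℝ 2 p), h1]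
      with x hx hx1
    rw [hx]
    simp only [he, PiLp.inner_apply, Submodule.coe_smul, hx1]
    simp [mul_comm]
  refine ⟨_, e, fun i => b.repr ⟨Y i, Submodule.subset_span ⟨i, rfl⟩⟩, ⟨?_, fun u => ?_, fun u => ?_,
    fun u => ?_⟩, fun i => ?_⟩
  · refine (WithLp.measurable_toLp 2 _).comp (measurable_pi_lambda _ fun j => ?_)
    exact (Lp.stronglyMeasurable _).measurable
  · exact (memLp_congr_ae (heT u)).2 (Lp.memLp _)
  · rw [integral_congr_ae (heT u)]
    exact hmean _ (Submodule.coe_mem _)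
  · have h1 : ∫ x, (inner ℝ u (e x)) ^ 2 ∂p = ∫ x, inner ℝ ((b.repr.symm u : Lp ℝ 2 p) x)
        ((b.repr.symm u : Lp ℝ 2 p) x) ∂p := by
      refine integral_congr_ae ?_
      filter_upwards [heT u] with x hx
      rw [hx]; simp [sq]
    rw [h1, ← L2.inner_def, real_inner_self_eq_norm_sq, ← Submodule.coe_norm,
      LinearIsometryEquiv.norm_map]
  · filter_upwards [hYae i, heT (b.repr ⟨Y i, Submodule.subset_span ⟨i, rfl⟩⟩)] with x h1 h2
    rw [h2, LinearIsometryEquiv.symm_apply_apply, h1]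
    ring

variable {p : Measure 𝒳} [IsProbabilityMeasure p] {k : ℕ} {e : 𝒳 → EuclideanSpace ℝ (Fin k)}

/-- A centered variable that is almost surely nonpositive vanishes almost surely, which contradicts
its second moment ‖u‖² > 0. -/
lemma IsWhite.measure_inner_pos (he : IsWhite p e) {u : EuclideanSpace ℝ (Fin k)} (hu : u ≠ 0) :
    p {x | 0 < inner ℝ u (e x)} ≠ 0 := by
  intro h0
  have h1 : ∀ᵐ x ∂p, inner ℝ u (e x) ≤ 0 := by
    rw [ae_iff]; simpa using h0
  have hi : Integrable (fun x => inner ℝ u (e x)) p := (he.memLp u).integrable one_le_two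
  have h2 : (fun x => -inner ℝ u (e x)) =ᵐ[p] 0 := by
    refine (integral_eq_zero_iff_of_nonneg_ae (h1.mono fun x hx => ?_) hi.neg).1 ?_
    · simpa using hx
    · simp only [Pi.neg_apply]
      rw [integral_neg, he.integral_eq_zero, neg_zero]
  have h3 : ∫ x, (inner ℝ u (e x)) ^ 2 ∂p = 0 := by
    rw [integral_congr_ae (g := fun _ => (0 : ℝ)) (h2.mono fun x hx => ?_)]
    · simp
    · have : inner ℝ u (e x) = 0 := by simpa using hx
      simp [this]
  rw [he.integral_sq] at h3
  exact hu (by simpa using h3)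

/-- The mean square of a sum of i.i.d. white vectors bounds the probability that it is large. -/
lemma IsWhite.measure_norm_sum_sq_ge_le (he : IsWhite p e) {N : ℕ} (hN : 0 < N) {A : ℝ}
    (hA : 0 < A) :
    Measure.pi (fun _ : Fin N => p) {x | A * N ≤ ‖∑ n, e (x n)‖ ^ 2} ≤
      ENNReal.ofReal (k / A) := by
  set P := Measure.pi (fun _ : Fin N => p) with hP
  have hm : ∀ u, MemLp (fun x : Fin N → 𝒳 => ∑ n, inner ℝ u (e (x n))) 2 P := fun u =>
    memLp_finsetSum _ fun n _ =>
      (he.memLp u).comp_measurePreserving (measurePreserving_eval (fun _ : Fin N => p) n)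
  have hmean : ∀ u, ∫ x : Fin N → 𝒳, ∑ n, inner ℝ u (e (x n)) ∂P = 0 := fun u => by
    have hi : ∀ n, Integrable (fun x : Fin N → 𝒳 => inner ℝ u (e (x n))) P := fun n =>
      ((he.memLp u).comp_measurePreserving
        (measurePreserving_eval (fun _ : Fin N => p) n)).integrable one_le_two
    rw [integral_finsetSum _ fun n _ => hi n]
    refine Finset.sum_eq_zero fun n _ => ?_
    rw [← he.integral_eq_zero u, ← (measurePreserving_eval (fun _ : Fin N => p) n).map_eq,
      integral_map (measurable_pi_apply n).aemeasurable]
    exact (he.measurable.const_inner).aestronglyMeasurable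
  have hsq : ∀ u, ∫ x : Fin N → 𝒳, (∑ n, inner ℝ u (e (x n))) ^ 2 ∂P = N * ‖u‖ ^ 2 := fun u => by
    have h := variance_sum_pi (μ := fun _ : Fin N => p) (X := fun _ x => inner ℝ u (e x))
      fun _ => he.memLp u
    have e1 : (∑ i : Fin N, fun ω : Fin N → 𝒳 => inner ℝ u (e (ω i))) =
      fun x : Fin N → 𝒳 => ∑ n, inner ℝ u (e (x n)) := by ext x; simp
    rw [e1, variance_of_integral_eq_zero (hm u).1.aemeasurable (hmean u),
      variance_of_integral_eq_zero (he.memLp u).1.aemeasurable (he.integral_eq_zero u),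
      he.integral_sq] at h
    rw [h]; simp
  have hnorm : ∀ x : Fin N → 𝒳, ‖∑ n, e (x n)‖ ^ 2 =
      ∑ j, (∑ n, inner ℝ (EuclideanSpace.single j (1 : ℝ)) (e (x n))) ^ 2 := fun x => by
    rw [EuclideanSpace.norm_sq_eq]
    refine Finset.sum_congr rfl fun j _ => ?_
    simp [Real.norm_eq_abs, sq_abs, EuclideanSpace.inner_single_left]
  have hint : Integrable (fun x : Fin N → 𝒳 => ‖∑ n, e (x n)‖ ^ 2) P := by
    simp_rw [hnorm]
    exact integrable_finsetSum _ fun j _ => (hm _).integrable_sq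
  have hI : ∫ x : Fin N → 𝒳, ‖∑ n, e (x n)‖ ^ 2 ∂P = N * k := by
    simp_rw [hnorm]
    rw [integral_finsetSum _ fun j _ => (hm _).integrable_sq]
    simp only [hsq]
    simp [mul_comm]
  have hmk := mul_meas_ge_le_integral_of_nonneg (ae_of_all _ fun x => by positivity) hint (A * N)
  rw [hI] at hmk
  have hN' : (0 : ℝ) < N := by exact_mod_cast hN
  rw [← ENNReal.ofReal_toReal (measure_ne_top P {x | A * N ≤ ‖∑ n, e (x n)‖ ^ 2})]
  refine ENNReal.ofReal_le_ofReal ?_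
  change P.real _ ≤ _
  rw [le_div_iff₀ hA]
  have : N * (P.real {x | A * N ≤ ‖∑ n, e (x n)‖ ^ 2} * A) ≤ N * k := by linarith
  exact le_of_mul_le_mul_left this hN'

end Whitening

/-! ### The simplex of admissible weights. -/

section CoresetWeights

lemma isCompact_coresetWeights {N : ℕ} (S : Finset (Fin N)) : IsCompact (coresetWeights S) := by
  refine (isCompact_Icc (a := (0 : Fin N → ℝ)) (b := fun _ => (N : ℝ))).of_isClosed_subset ?_ ?_
  · have h : coresetWeights S = (⋂ n, {w : Fin N → ℝ | 0 ≤ w n}) ∩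
        ((⋂ n, ⋂ _ : n ∉ S, {w : Fin N → ℝ | w n = 0}) ∩ {w | ∑ n, w n = (N : ℝ)}) := by
      ext w; simp [coresetWeights]
    rw [h]
    refine (isClosed_iInter fun n => isClosed_le continuous_const (continuous_apply n)).inter
      ((isClosed_iInter fun n => isClosed_iInter fun _ =>
        isClosed_eq (continuous_apply n) continuous_const).inter
        (isClosed_eq (by fun_prop) continuous_const))
  · rintro w ⟨h0, -, hs⟩
    refine ⟨h0, fun n => ?_⟩
    rw [← hs]
    exact Finset.single_le_sum (fun i _ => h0 i) (Finset.mem_univ n)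

lemma convex_coresetWeights {N : ℕ} (S : Finset (Fin N)) : Convex ℝ (coresetWeights S) := by
  rintro w ⟨h1, h2, h3⟩ w' ⟨h1', h2', h3'⟩ a b ha hb hab
  refine ⟨fun n => ?_, fun n hn => ?_, ?_⟩
  · have := h1 n; have := h1' n
    simp only [Pi.add_apply, Pi.smul_apply, smul_eq_mul]; positivity
  · simp [h2 n hn, h2' n hn]
  · simp only [Pi.add_apply, Pi.smul_apply, smul_eq_mul, Finset.sum_add_distrib, ← Finset.mul_sum,
      h3, h3']
    rw [← add_mul, hab, one_mul]

lemma single_mem_coresetWeights {N : ℕ} {S : Finset (Fin N)} {n : Fin N} (hn : n ∈ S) :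
    Pi.single n (N : ℝ) ∈ coresetWeights S := by
  refine ⟨fun m => ?_, fun m hm => ?_, ?_⟩
  · by_cases h : m = n
    · subst h; simp
    · simp [h]
  · exact Pi.single_eq_of_ne (by rintro rfl; exact hm hn) _
  · simp

lemma le_of_mem_coresetWeights {N : ℕ} {S : Finset (Fin N)} {w : Fin N → ℝ}
    (hw : w ∈ coresetWeights S) (n : Fin N) : w n ≤ N := by
  rw [← hw.2.2]
  exact Finset.single_le_sum (fun i _ => hw.1 i) (Finset.mem_univ n)

end CoresetWeights

/-! ### Weights that reproduce the full-data sum of e. -/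

section MomentMatching

variable {𝒳 : Type*} [MeasurableSpace 𝒳] {p : Measure 𝒳} [IsProbabilityMeasure p] {k : ℕ}
  {e : 𝒳 → EuclideanSpace ℝ (Fin k)}

/-- Finitely many events of positive probability witness, uniformly in the direction, that a white
vector has mass in every open half-space. -/
lemma IsWhite.exists_finset_events (he : IsWhite p e) :
    ∃ (𝒜 : Finset (Set 𝒳)) (δ : ℝ), 0 < δ ∧ (∀ A ∈ 𝒜, MeasurableSet A ∧ p A ≠ 0) ∧
      ∀ u ∈ Metric.sphere (0 : EuclideanSpace ℝ (Fin k)) 1, ∃ A ∈ 𝒜, ∀ x ∈ A,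
        δ < inner ℝ u (e x) := by
  classical
  refine (isCompact_sphere (0 : EuclideanSpace ℝ (Fin k)) 1).induction_on
    (p := fun s => ∃ (𝒜 : Finset (Set 𝒳)) (δ : ℝ), 0 < δ ∧ (∀ A ∈ 𝒜, MeasurableSet A ∧ p A ≠ 0) ∧
      ∀ u ∈ s, ∃ A ∈ 𝒜, ∀ x ∈ A, δ < inner ℝ u (e x)) ?_ ?_ ?_ ?_
  · exact ⟨∅, 1, one_pos, by simp, by simp⟩
  · rintro s t hst ⟨𝒜, δ, hδ, h1, h2⟩
    exact ⟨𝒜, δ, hδ, h1, fun u hu => h2 u (hst hu)⟩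
  · rintro s t ⟨𝒜, δ, hδ, h1, h2⟩ ⟨𝒜', δ', hδ', h1', h2'⟩
    refine ⟨𝒜 ∪ 𝒜', min δ δ', lt_min hδ hδ', fun A hA => ?_, fun u hu => ?_⟩
    · rcases Finset.mem_union.1 hA with h | h
      exacts [h1 A h, h1' A h]
    · rcases hu with hu | hu
      · obtain ⟨A, hA, h⟩ := h2 u hu
        exact ⟨A, Finset.mem_union_left _ hA, fun x hx => (min_le_left _ _).trans_lt (h x hx)⟩
      · obtain ⟨A, hA, h⟩ := h2' u hu
        exact ⟨A, Finset.mem_union_right _ hA, fun x hx => (min_le_right _ _).trans_lt (h x hx)⟩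
  · intro u hu
    have hu0 : u ≠ 0 := by
      rintro rfl; simp at hu
    -- Truncating ‖e‖ makes the inner product Lipschitz in the direction, uniformly over the event,
    -- so one event serves a whole neighbourhood of u.
    set A : ℕ → Set 𝒳 := fun m => {x | 1 / ((m : ℝ) + 1) < inner ℝ u (e x) ∧ ‖e x‖ ≤ m} with hA
    obtain ⟨m, hm⟩ : ∃ m, p (A m) ≠ 0 := by
      by_contra! h
      refine he.measure_inner_pos hu0 (measure_mono_null (fun x hx => ?_) (measure_iUnion_null h))
      obtain ⟨m₁, hm₁⟩ := exists_nat_one_div_lt (show 0 < inner ℝ u (e x) from hx)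
      obtain ⟨m₂, hm₂⟩ := exists_nat_ge ‖e x‖
      refine Set.mem_iUnion.2 ⟨max m₁ m₂, lt_of_le_of_lt ?_ hm₁, hm₂.trans ?_⟩
      · exact one_div_le_one_div_of_le (by positivity) (by simp)
      · simp
    have hm1 : (0 : ℝ) < m + 1 := by positivity
    -- Half of the margin 1/(m+1): moving the direction by η/(m+1) costs at most η.
    set η : ℝ := 1 / (2 * ((m : ℝ) + 1)) with hη
    refine ⟨Metric.ball u (η / (m + 1)), nhdsWithin_le_nhds (Metric.ball_mem_nhds _ (by positivity)),
      {A m}, η, by positivity, fun B hB => ?_, fun u' hu' => ⟨A m, by simp, fun x hx => ?_⟩⟩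
    · rw [Finset.mem_singleton] at hB
      subst hB
      refine ⟨?_, hm⟩
      exact (measurableSet_lt measurable_const (g := fun x => inner ℝ u (e x)) he.measurable.const_inner).inter
        (measurableSet_le (f := fun x => ‖e x‖) he.measurable.norm measurable_const)
    · have h1 : |inner ℝ (u' - u) (e x)| ≤ ‖u' - u‖ * ‖e x‖ := abs_real_inner_le_norm _ _
      have h2 : ‖u' - u‖ * ‖e x‖ ≤ η / (m + 1) * (m + 1) :=
        mul_le_mul (mem_ball_iff_norm.1 hu').le (hx.2.trans (by linarith)) (norm_nonneg _)
          (by positivity)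
      rw [div_mul_cancel₀ _ hm1.ne'] at h2
      have h3 : 1 / ((m : ℝ) + 1) = 2 * η := by rw [hη]; field_simp
      have h4 := hx.1
      rw [h3] at h4
      rw [inner_sub_left] at h1
      linarith [(abs_le.1 (h1.trans h2)).1]

/-- If the selected points hit sufficiently many events and the sum of the data is of smaller order
than its size, then the selected points can be weighted so as to match the sum. -/
lemma exists_coresetWeights_sum_eq {𝒳 : Type*} {k : ℕ} {e : 𝒳 → EuclideanSpace ℝ (Fin k)} {δ : ℝ}
    {𝒜 : Finset (Set 𝒳)}
    (h𝒜 : ∀ u ∈ Metric.sphere (0 : EuclideanSpace ℝ (Fin k)) 1, ∃ A ∈ 𝒜, ∀ x ∈ A,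
      δ < inner ℝ u (e x))
    {N : ℕ} {S : Finset (Fin N)} (hS : S.Nonempty) {x : Fin N → 𝒳}
    (hit : ∀ A ∈ 𝒜, ∃ n ∈ S, x n ∈ A) {y : EuclideanSpace ℝ (Fin k)} (hy : ‖y‖ ≤ δ * N) :
    ∃ w ∈ coresetWeights S, ∑ n, w n • e (x n) = y := by
  set L : (Fin N → ℝ) →ₗ[ℝ] EuclideanSpace ℝ (Fin k) :=
    Fintype.linearCombination ℝ (fun n => e (x n)) with hL
  have hLw : ∀ w, L w = ∑ n, w n • e (x n) := fun w => rfl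
  by_contra hcon
  have hnot : y ∉ L '' coresetWeights S := by
    rintro ⟨w, hw, h⟩
    exact hcon ⟨w, hw, h⟩
  have hclosed : IsClosed (L '' coresetWeights S) :=
    ((isCompact_coresetWeights S).image L.continuous_of_finiteDimensional).isClosed
  -- If y is not attainable, a direction u strictly separates it from all the vertices N e(x_n), n ∈
  -- S. A selected point in the event belonging to u/‖u‖ exceeds this bound, as ⟨u, y⟩ ≤ δ N ‖u‖.
  obtain ⟨φ, c, h1, h2⟩ := geometric_hahn_banach_closed_point
    ((convex_coresetWeights S).linear_image L) hclosed hnot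
  obtain ⟨u, rfl⟩ := (InnerProductSpace.toDual ℝ (EuclideanSpace ℝ (Fin k))).surjective φ
  simp only [InnerProductSpace.toDual_apply_apply] at h1 h2
  have h3 : ∀ n ∈ S, N * inner ℝ u (e (x n)) < inner ℝ u y := fun n hn => by
    have := (h1 _ ⟨_, single_mem_coresetWeights hn, rfl⟩).trans h2
    rw [hLw, Finset.sum_eq_single n (fun m _ hm => by simp [hm]) (by simp)] at this
    simpa [inner_smul_right] using this
  obtain ⟨n₀, hn₀⟩ := hS
  have hu : u ≠ 0 := by
    rintro rfl
    simpa using h3 n₀ hn₀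
  have hu' : 0 < ‖u‖ := norm_pos_iff.2 hu
  obtain ⟨A, hA, hAu⟩ := h𝒜 (‖u‖⁻¹ • u) (by simp [norm_smul, hu'.ne'])
  obtain ⟨n, hn, hxn⟩ := hit A hA
  have h4 := hAu _ hxn
  rw [real_inner_smul_left, inv_mul_eq_div, lt_div_iff₀ hu'] at h4
  have h5 : inner ℝ u y ≤ ‖u‖ * (δ * N) :=
    (real_inner_le_norm u y).trans (mul_le_mul_of_nonneg_left hy hu'.le)
  have h6 : (N : ℝ) * (δ * ‖u‖) ≤ N * inner ℝ u (e (x n)) := by gcongr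
  linarith [h3 n hn]

end MomentMatching

/-! ### Probabilities under the joint law of data and subset. -/

section SampleLaw

variable {𝒳 : Type*} [MeasurableSpace 𝒳] {p : Measure 𝒳}

/-- Only an inequality, since the uniform law is the zero measure when no subset has size M. -/
lemma sampleLaw_fst_le {N : ℕ} (M : ℕ) (B : Set (Fin N → 𝒳)) :
    sampleLaw p N M {ω | ω.1 ∈ B} ≤ Measure.pi (fun _ : Fin N => p) B := by
  have h : {ω : (Fin N → 𝒳) × Finset (Fin N) | ω.1 ∈ B} = B ×ˢ Set.univ := by ext; simp
  rw [h, sampleLaw, Measure.prod_prod]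
  exact mul_le_of_le_one_right' prob_le_one

variable [IsProbabilityMeasure p]

/-- For a fixed subset of size M the data indexed by it are M independent draws; integrating over
the independent subset keeps the bound. -/
lemma sampleLaw_forall_notMem_le {N : ℕ} (M : ℕ) {A : Set 𝒳} (hA : MeasurableSet A) :
    sampleLaw p N M {ω | ∀ n ∈ ω.2, ω.1 n ∉ A} ≤ p Aᶜ ^ M := by
  classical
  have hset : {ω : (Fin N → 𝒳) × Finset (Fin N) | ∀ n ∈ ω.2, ω.1 n ∉ A} =
      ⋂ n, ({ω | n ∈ ω.2}ᶜ ∪ {ω | ω.1 n ∈ A}ᶜ) := by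
    ext ω
    simp only [Set.mem_ofPred_eq, Set.mem_iInter, Set.mem_union, Set.mem_compl_iff]
    exact forall_congr' fun n => imp_iff_not_or
  have hmeas : MeasurableSet {ω : (Fin N → 𝒳) × Finset (Fin N) | ∀ n ∈ ω.2, ω.1 n ∉ A} := by
    rw [hset]
    refine MeasurableSet.iInter fun n => MeasurableSet.union ?_ ?_
    · exact ((measurable_finset_iff.1 measurable_id n).setOf.preimage
        measurable_snd).compl
    · exact (((measurable_pi_apply n).comp measurable_fst) hA).compl
  rw [sampleLaw, Measure.prod_apply_symm hmeas]
  have hae : ∀ᵐ S ∂(uniformOn {S : Finset (Fin N) | S.card = M}), S.card = M :=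
    ae_cond_mem (Set.toFinite _).measurableSet
  have hle : ∀ᵐ S ∂(uniformOn {S : Finset (Fin N) | S.card = M}),
      Measure.pi (fun _ : Fin N => p)
        ((fun x => (x, S)) ⁻¹' {ω : (Fin N → 𝒳) × Finset (Fin N) | ∀ n ∈ ω.2, ω.1 n ∉ A}) ≤
      p Aᶜ ^ M := by
    filter_upwards [hae] with S hS
    have h : (fun x => (x, S)) ⁻¹' {ω : (Fin N → 𝒳) × Finset (Fin N) | ∀ n ∈ ω.2, ω.1 n ∉ A} =
        Set.univ.pi fun n => if n ∈ S then Aᶜ else Set.univ := by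
      ext x
      simp only [Set.mem_preimage, Set.mem_ofPred_eq, Set.mem_univ_pi]
      refine forall_congr' fun n => ?_
      by_cases hn : n ∈ S <;> simp [hn]
    rw [h, Measure.pi_pi]
    have h2 : ∀ n, p (if n ∈ S then Aᶜ else Set.univ) = if n ∈ S then p Aᶜ else 1 := fun n => by
      split_ifs <;> simp
    simp only [h2, Finset.prod_ite_mem, Finset.univ_inter, Finset.prod_const, hS, le_refl]
  refine (lintegral_mono_ae hle).trans ?_
  rw [lintegral_const]
  exact mul_le_of_le_one_right' prob_le_one

lemma tendsto_sampleLaw_forall_notMem {M : ℕ → ℕ} (hM : Tendsto M atTop atTop) {A : Set 𝒳}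
    (hA : MeasurableSet A) (hpos : p A ≠ 0) :
    Tendsto (fun N => sampleLaw p N (M N) {ω | ∀ n ∈ ω.2, ω.1 n ∉ A}) atTop (𝓝 0) := by
  refine tendsto_of_tendsto_of_tendsto_of_le_of_le tendsto_const_nhds
    ((ENNReal.tendsto_pow_atTop_nhds_zero_of_lt_one ?_).comp hM) (fun _ => zero_le)
    fun N => sampleLaw_forall_notMem_le (M N) hA
  rw [prob_compl_eq_one_sub hA]
  exact ENNReal.sub_lt_self ENNReal.one_ne_top one_ne_zero hpos

lemma pi_exists_mem_eq_zero {N : ℕ} {B : Set 𝒳} (hB : p B = 0) :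
    Measure.pi (fun _ : Fin N => p) {x | ∃ n, x n ∈ B} = 0 := by
  have h : {x : Fin N → 𝒳 | ∃ n, x n ∈ B} = ⋃ n, Function.eval n ⁻¹' B := by
    ext x; simp
  rw [h]
  exact measure_iUnion_null fun n =>
    (measurePreserving_eval (fun _ : Fin N => p) n).quasiMeasurePreserving.preimage_null hB

/-- Markov's inequality for the sum of an i.i.d. sample. -/
lemma pi_sq_le_sum_le {N : ℕ} (hN : 0 < N) {Q : 𝒳 → ℝ≥0∞} (hQ : Measurable Q) :
    Measure.pi (fun _ : Fin N => p) {x | (N : ℝ≥0∞) ^ 2 ≤ ∑ n, Q (x n)} ≤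
      (∫⁻ x, Q x ∂p) / N := by
  have hN0 : (N : ℝ≥0∞) ≠ 0 := by exact_mod_cast hN.ne'
  have hm : ∀ n : Fin N, Measurable fun x : Fin N → 𝒳 => Q (x n) := fun n =>
    hQ.comp (measurable_pi_apply n)
  refine (meas_ge_le_lintegral_div (Finset.measurable_fun_sum _ fun n _ => hm n).aemeasurable
    (by positivity) (ENNReal.pow_ne_top (ENNReal.natCast_ne_top N))).trans (le_of_eq ?_)
  rw [lintegral_finsetSum _ fun n _ => hm n]
  have h : ∀ n : Fin N, ∫⁻ x : Fin N → 𝒳, Q (x n) ∂(Measure.pi fun _ : Fin N => p) =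
      ∫⁻ x, Q x ∂p := fun n =>
    (measurePreserving_eval (fun _ : Fin N => p) n).lintegral_comp hQ
  simp only [h, Finset.sum_const, Finset.card_univ, Fintype.card_fin, nsmul_eq_mul]
  rw [sq, ENNReal.mul_div_mul_left _ _ hN0 (ENNReal.natCast_ne_top N)]

/-- If the probability of an exceptional event at each fixed positive level tends to zero, then so
does its probability along some sequence of levels that tends to zero. -/
lemma exists_tendsto_zero_of_forall_level {P : ℕ → ℝ≥0∞ → ℝ≥0∞}
    (hP : ∀ m : ℕ, Tendsto (fun N => P N ((m : ℝ≥0∞) + 1)⁻¹) atTop (𝓝 0)) :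
    ∃ κ : ℕ → ℝ≥0∞, Tendsto κ atTop (𝓝 0) ∧ Tendsto (fun N => P N (κ N)) atTop (𝓝 0) := by
  classical
  -- The level used at N is 1/(m+1) for the largest m ≤ N at which the probability is also at most
  -- 1/(m+1). The value m = 0 is always admitted so that a largest one exists.
  set q : ℕ → ℕ → Prop := fun N m => m = 0 ∨ P N ((m : ℝ≥0∞) + 1)⁻¹ ≤ ((m : ℝ≥0∞) + 1)⁻¹ with hq
  set μ : ℕ → ℕ := fun N => Nat.findGreatest (q N) N with hμ
  have hlarge : ∀ m, ∀ᶠ N in atTop, m ≤ μ N := fun m => by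
    have h1 : ∀ᶠ N in atTop, P N ((m : ℝ≥0∞) + 1)⁻¹ ≤ ((m : ℝ≥0∞) + 1)⁻¹ :=
      (hP m).eventually_le_const (ENNReal.inv_pos.2 (by finiteness))
    filter_upwards [h1, eventually_ge_atTop m] with N hN hmN
    exact Nat.le_findGreatest hmN (Or.inr hN)
  have hμt : Tendsto μ atTop atTop := tendsto_atTop.2 hlarge
  have hinv : Tendsto (fun N => ((μ N : ℝ≥0∞) + 1)⁻¹) atTop (𝓝 0) := by
    have h : Tendsto (fun m : ℕ => ((m : ℝ≥0∞) + 1)⁻¹) atTop (𝓝 0) := by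
      refine (ENNReal.tendsto_inv_nat_nhds_zero.comp (tendsto_add_atTop_nat 1)).congr fun m => ?_
      simp
    exact h.comp hμt
  refine ⟨fun N => ((μ N : ℝ≥0∞) + 1)⁻¹, hinv, ?_⟩
  refine tendsto_of_tendsto_of_tendsto_of_le_of_le' tendsto_const_nhds hinv
    (Eventually.of_forall fun _ => zero_le) ?_
  filter_upwards [hlarge 1] with N hN
  have hspec : q N (μ N) := Nat.findGreatest_spec (P := q N) (Nat.zero_le N) (Or.inl rfl)
  rcases hspec with h | h
  · omega
  · exact h

end SampleLaw

/-! ### Posteriors as tilts of the prior. -/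

section Posterior

lemma tilted_sub_const {α : Type*} [MeasurableSpace α] (μ : Measure α) (g : α → ℝ) (c : ℝ) :
    (μ.tilted fun x => g x - c) = μ.tilted g := by
  simp only [Measure.tilted, Real.exp_sub, integral_div]
  congr 1
  ext x
  rw [div_div_div_cancel_right₀ (Real.exp_pos c).ne']

variable {𝒳 : Type*} {D N : ℕ} {Θ : Set (EuclideanSpace ℝ (Fin D))}
  {f : 𝒳 → EuclideanSpace ℝ (Fin D) → ℝ} {π₀ : EuclideanSpace ℝ (Fin D) → ℝ}

/-- The prior distribution on `Θ`. -/
noncomputable def priorMeasure (Θ : Set (EuclideanSpace ℝ (Fin D)))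
    (π₀ : EuclideanSpace ℝ (Fin D) → ℝ) : Measure (EuclideanSpace ℝ (Fin D)) :=
  (volume.restrict Θ).withDensity fun θ => ENNReal.ofReal (π₀ θ)

lemma coresetPosterior_eq_tilted [IsProbabilityMeasure (priorMeasure Θ π₀)] (hπm : Measurable π₀)
    (hfm : ∀ x, AEMeasurable (f x) (volume.restrict Θ)) {x : Fin N → 𝒳} {w : Fin N → ℝ}
    (hint : Integrable (fun θ => Real.exp (∑ n, w n * f (x n) θ)) (priorMeasure Θ π₀)) :
    coresetPosterior Θ f π₀ x w = (priorMeasure Θ π₀).tilted fun θ => ∑ n, w n * f (x n) θ := by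
  have hm : AEMeasurable (fun θ => Real.exp (∑ n, w n * f (x n) θ)) (volume.restrict Θ) :=
    Real.measurable_exp.comp_aemeasurable
      (Finset.aemeasurable_fun_sum _ fun n _ => (hfm (x n)).const_mul _)
  have hZ : normalizingConstant Θ f π₀ x w =
      ENNReal.ofReal (∫ θ, Real.exp (∑ n, w n * f (x n) θ) ∂(priorMeasure Θ π₀)) := by
    rw [ofReal_integral_eq_lintegral_ofReal hint (ae_of_all _ fun _ => (Real.exp_pos _).le),
      priorMeasure, lintegral_withDensity_eq_lintegral_mul_non_measurable _ hπm.ennreal_ofReal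
      (ae_of_all _ fun _ => ENNReal.ofReal_lt_top), normalizingConstant]
    refine lintegral_congr fun θ => ?_
    rw [unnormalizedDensity, ENNReal.ofReal_mul (Real.exp_pos _).le, Pi.mul_apply, mul_comm]
  have hpos := integral_exp_pos hint
  rw [coresetPosterior, hZ, Measure.tilted]
  nth_rw 2 [priorMeasure]
  rw [← withDensity_mul₀ hπm.ennreal_ofReal.aemeasurable (hm.div_const _).ennreal_ofReal]
  refine congrArg _ (funext fun θ => ?_)
  rw [unnormalizedDensity, ENNReal.ofReal_mul (Real.exp_pos _).le, Pi.mul_apply,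
    ENNReal.ofReal_div_of_pos hpos, div_eq_mul_inv]
  ring

lemma ae_priorMeasure_mem (hΘ : MeasurableSet Θ) : ∀ᵐ θ ∂(priorMeasure Θ π₀), θ ∈ Θ :=
  (withDensity_absolutelyContinuous _ _).ae_le (ae_restrict_mem hΘ)

lemma sum_mul_le_of_mem_coresetWeights {w : Fin N → ℝ} {S : Finset (Fin N)}
    (hw : w ∈ coresetWeights S) {C : Fin N → ℝ} {F : Fin N → ℝ} (hF : ∀ n, F n ≤ C n) :
    ∑ n, w n * F n ≤ ∑ n, N * |C n| :=
  Finset.sum_le_sum fun n _ =>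
    (mul_le_mul_of_nonneg_left ((hF n).trans (le_abs_self _)) (hw.1 n)).trans
      (mul_le_mul_of_nonneg_right (le_of_mem_coresetWeights hw n) (abs_nonneg _))

/-- This lets the full posterior be treated by the same lemmas as the weighted ones. -/
lemma one_mem_coresetWeights_univ : (fun _ => 1 : Fin N → ℝ) ∈ coresetWeights Finset.univ := by
  simp [coresetWeights]

lemma integrable_exp_sum_of_bddAbove [IsProbabilityMeasure (priorMeasure Θ π₀)]
    (hΘ : MeasurableSet Θ) (hfm : ∀ x, AEMeasurable (f x) (volume.restrict Θ)) {C : 𝒳 → ℝ}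
    (hC : ∀ x, ∀ θ ∈ Θ, f x θ ≤ C x) (x : Fin N → 𝒳) {S : Finset (Fin N)} {w : Fin N → ℝ}
    (hw : w ∈ coresetWeights S) :
    Integrable (fun θ => Real.exp (∑ n, w n * f (x n) θ)) (priorMeasure Θ π₀) := by
  refine Integrable.of_bound (Real.measurable_exp.comp_aemeasurable
    (Finset.aemeasurable_fun_sum _ fun n _ => ((hfm (x n)).const_mul _).mono_ac
      (withDensity_absolutelyContinuous _ _))).aestronglyMeasurable
    (Real.exp (∑ n, N * |C (x n)|)) ?_
  filter_upwards [ae_priorMeasure_mem hΘ] with θ hθ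
  rw [Real.norm_of_nonneg (Real.exp_pos _).le, Real.exp_le_exp]
  exact sum_mul_le_of_mem_coresetWeights hw fun n => hC _ θ hθ

lemma exists_isLeast_coresetKLValues [IsProbabilityMeasure (priorMeasure Θ π₀)]
    (hπm : Measurable π₀)
    (hΘ : MeasurableSet Θ) (hfm : ∀ x, AEMeasurable (f x) (volume.restrict Θ)) {C : 𝒳 → ℝ}
    (hC : ∀ x, ∀ θ ∈ Θ, f x θ ≤ C x) (x : Fin N → 𝒳) {S : Finset (Fin N)} (hS : S.Nonempty) :
    ∃ v, IsLeast (coresetKLValues Θ f π₀ x S) v := by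
  obtain ⟨n, hn⟩ := hS
  have hb : ∀ {T : Finset (Fin N)}, ∀ w ∈ coresetWeights T, ∀ᵐ θ ∂(priorMeasure Θ π₀),
      ∑ n, w n * f (x n) θ ≤ ∑ n, N * |C (x n)| := fun w hw =>
    (ae_priorMeasure_mem hΘ).mono fun θ hθ =>
      sum_mul_le_of_mem_coresetWeights hw fun n => hC _ θ hθ
  obtain ⟨v, hv⟩ := exists_isLeast_klDiv_tilted (μ := priorMeasure Θ π₀)
    (isCompact_coresetWeights S) ⟨_, single_mem_coresetWeights hn⟩ (F := fun n => f (x n))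
    (fun n => (hfm (x n)).mono_ac (withDensity_absolutelyContinuous _ _))
    (hb _ one_mem_coresetWeights_univ) hb
  refine ⟨v, ?_⟩
  convert hv using 1
  refine Set.image_congr fun w hw => ?_
  rw [fullPosterior, coresetPosterior_eq_tilted hπm hfm
      (integrable_exp_sum_of_bddAbove hΘ hfm hC x hw), coresetPosterior_eq_tilted hπm hfm
      (integrable_exp_sum_of_bddAbove hΘ hfm hC x one_mem_coresetWeights_univ)]

lemma coresetPosterior_eq_tilted_sub [IsProbabilityMeasure (priorMeasure Θ π₀)]
    (hπm : Measurable π₀)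
    (hΘ : MeasurableSet Θ) (hfm : ∀ x, AEMeasurable (f x) (volume.restrict Θ)) {C : 𝒳 → ℝ}
    (hC : ∀ x, ∀ θ ∈ Θ, f x θ ≤ C x) (x : Fin N → 𝒳) {S : Finset (Fin N)} {w : Fin N → ℝ}
    (hw : w ∈ coresetWeights S) (θ₀ : EuclideanSpace ℝ (Fin D)) :
    coresetPosterior Θ f π₀ x w =
      (priorMeasure Θ π₀).tilted fun θ => ∑ n, w n * (f (x n) θ - f (x n) θ₀) := by
  rw [coresetPosterior_eq_tilted hπm hfm (integrable_exp_sum_of_bddAbove hΘ hfm hC x hw),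
    ← tilted_sub_const _ _ (∑ n, w n * f (x n) θ₀)]
  simp only [mul_sub, Finset.sum_sub_distrib]

end Posterior

/-! ### Exchanging the variance with the average over Θ. -/

section AveragedVariance

variable {𝒳 : Type*} [MeasurableSpace 𝒳] {D : ℕ} {Θ : Set (EuclideanSpace ℝ (Fin D))}
  {F : 𝒳 → EuclideanSpace ℝ (Fin D) → ℝ}

/-- The weighted average over `Θ` of the variance of a random function with continuous paths is the
mean of the weighted average of its squared deviation. -/
lemma lintegral_evariance_eq (p : Measure 𝒳) [IsProbabilityMeasure p] (hΘ : MeasurableSet Θ)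
    (hcont : ∀ x, ContinuousOn (F x) Θ) (hmeas : ∀ θ ∈ Θ, Measurable fun x => F x θ)
    {q : EuclideanSpace ℝ (Fin D) → ℝ≥0∞} (hq : Measurable q) :
    (∀ x, AEMeasurable (fun θ => ‖F x θ - ∫ y, F y θ ∂p‖ₑ ^ 2 * q θ) (volume.restrict Θ)) ∧
      Measurable (fun x => ∫⁻ θ in Θ, ‖F x θ - ∫ y, F y θ ∂p‖ₑ ^ 2 * q θ) ∧
      ∫⁻ x, (∫⁻ θ in Θ, ‖F x θ - ∫ y, F y θ ∂p‖ₑ ^ 2 * q θ) ∂p =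
        ∫⁻ θ in Θ, evariance (fun x => F x θ) p * q θ := by
  set u : Θ → 𝒳 → ℝ := fun θ x => F x θ with hu
  -- Continuity in θ and measurability in x give joint measurability. Both are available on Θ only,
  -- hence the passage to the subtype.
  have hjoint : StronglyMeasurable (Function.uncurry u) :=
    stronglyMeasurable_uncurry_of_continuous_of_stronglyMeasurable
      (fun x => (hcont x).domRestrict) fun θ => (hmeas θ θ.2).stronglyMeasurable
  have hmean : Measurable fun θ : Θ => ∫ y, u θ y ∂p := hjoint.integral_prod_right.measurable
  have hdev : Measurable (Function.uncurry fun (θ : Θ) (x : 𝒳) =>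
      ‖F x θ - ∫ y, F y θ ∂p‖ₑ ^ 2 * q θ) :=
    (((hjoint.measurable.sub (hmean.comp measurable_fst)).enorm).pow_const 2).mul
      (hq.comp (measurable_subtype_coe.comp measurable_fst))
  have hsub : ∀ G : EuclideanSpace ℝ (Fin D) → ℝ≥0∞,
      ∫⁻ θ in Θ, G θ = ∫⁻ θ : Θ, G θ ∂(Measure.comap Subtype.val volume) := fun G =>
    (lintegral_subtype_comap hΘ G).symm
  have : SigmaFinite (Measure.comap (Subtype.val : Θ → EuclideanSpace ℝ (Fin D)) volume) :=
    SigmaFinite.of_map _ measurable_subtype_coe.aemeasurable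
      (by rw [map_comap_subtype_coe hΘ]; infer_instance)
  simp only [hsub]
  refine ⟨fun x => ?_, hdev.lintegral_prod_left', ?_⟩
  · rw [aemeasurable_restrict_iff_comap_subtype hΘ]
    exact (hdev.comp (measurable_id.prodMk measurable_const)).aemeasurable
  rw [lintegral_lintegral_swap (f := fun x (θ : Θ) => ‖F x θ - ∫ y, F y θ ∂p‖ₑ ^ 2 * q θ)
    (hdev.comp measurable_swap).aemeasurable]
  refine lintegral_congr fun θ => ?_
  rw [evariance, lintegral_mul_const]
  exact ((hmeas θ θ.2).sub_const _).enorm.pow_const 2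

end AveragedVariance

/-! ### Affine expansion of the potential near θ₀. -/

section LocalExpansion

variable {𝒳 : Type*} [MeasurableSpace 𝒳] {p : Measure 𝒳} [IsProbabilityMeasure p]

lemma variance_add_le {X Y : 𝒳 → ℝ} (hX : MemLp X 2 p) (hY : MemLp Y 2 p) :
    variance (X + Y) p ≤ 2 * variance X p + 2 * variance Y p := by
  have h1 := variance_add hX hY
  have h2 := variance_sub hX hY
  linarith [variance_nonneg (X - Y) p]

/-- Near `θ₀`, the differences of the finite-dimensional part of the potential are affine in a white
vector, with a coefficient that is linearly small and a mean that is quadratically small. -/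
lemma exists_isWhite_expansion {D : ℕ} {Θ : Set (EuclideanSpace ℝ (Fin D))}
    {f f₁ f₂ : 𝒳 → EuclideanSpace ℝ (Fin D) → ℝ}
    (hf_meas : ∀ θ ∈ Θ, Measurable (fun x => f x θ))
    (hf₁_meas : ∀ θ ∈ Θ, Measurable (fun x => f₁ x θ))
    (hf_int : ∀ θ ∈ Θ, Integrable (fun x => f x θ) p)
    {θ₀ : EuclideanSpace ℝ (Fin D)} (hθ₀ : θ₀ ∈ Θ)
    (hsplit : ∀ x, ∀ θ ∈ Θ, f x θ = f₁ x θ + f₂ x θ)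
    (hfin : FiniteDimensional ℝ (differenceSpan Θ f₁ θ₀))
    {ε L₁ L₂ r₀ : ℝ} (hε : 0 < ε) (hL₂ : 0 ≤ L₂) (hr₀ : 0 ≤ r₀)
    {R : 𝒳 → ℝ} (hR_pos : ∀ x, 0 < R x) (hR_sq : MemLp R 2 p)
    (hrem : ∀ x, ∀ θ ∈ Θ, ‖θ - θ₀‖ ≤ ε → |f₂ x θ| ≤ R x * r₀ * ‖θ - θ₀‖ ^ 2)
    (hmean : ∀ θ ∈ Θ, ‖θ - θ₀‖ ≤ ε →
      |meanPotential p f θ₀ - meanPotential p f θ| ≤ L₁ * ‖θ - θ₀‖ ^ 2)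
    (hvar : ∀ θ ∈ Θ, ‖θ - θ₀‖ ≤ ε →
      evariance (fun x => f x θ₀ - f x θ) p ≤ ENNReal.ofReal (L₂ * ‖θ - θ₀‖ ^ 2)) :
    ∃ (k : ℕ) (e : 𝒳 → EuclideanSpace ℝ (Fin k))
      (b : EuclideanSpace ℝ (Fin D) → EuclideanSpace ℝ (Fin k))
      (m : EuclideanSpace ℝ (Fin D) → ℝ) (ξ : EuclideanSpace ℝ (Fin k)) (C : ℝ),
      IsWhite p e ∧ 0 ≤ C ∧
      (∀ᵐ x ∂p, R x = ∫ y, R y ∂p + inner ℝ ξ (e x) ∧ ∀ θ ∈ Θ, ‖θ - θ₀‖ ≤ ε →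
        f₁ x θ - f₁ x θ₀ = m θ + inner ℝ (b θ) (e x)) ∧
      ∀ θ ∈ Θ, ‖θ - θ₀‖ ≤ ε → ‖b θ‖ ≤ C * ‖θ - θ₀‖ ∧
        |m θ| ≤ (L₁ + r₀ * ∫ y, R y ∂p) * ‖θ - θ₀‖ ^ 2 := by
  classical
  have hf₂0 : ∀ x, f₂ x θ₀ = 0 := fun x => by
    simpa using hrem x θ₀ hθ₀ (by simpa using hε.le)
  have hf₂_memLp : ∀ θ ∈ Θ, ‖θ - θ₀‖ ≤ ε → MemLp (fun x => f₂ x θ) 2 p := fun θ hθ hle => by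
    refine hR_sq.of_le_mul (c := r₀ * ‖θ - θ₀‖ ^ 2) ?_ (ae_of_all _ fun x => ?_)
    · have : (fun x => f₂ x θ) = fun x => f x θ - f₁ x θ := by
        ext x; rw [hsplit x θ hθ]; ring
      rw [this]
      exact ((hf_meas θ hθ).sub (hf₁_meas θ hθ)).aestronglyMeasurable
    · rw [Real.norm_eq_abs, Real.norm_of_nonneg (hR_pos x).le]
      linarith [hrem x θ hθ hle]
  have hF_memLp : ∀ θ ∈ Θ, ‖θ - θ₀‖ ≤ ε → MemLp (fun x => f x θ₀ - f x θ) 2 p :=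
    fun θ hθ hle =>
      (evariance_lt_top_iff_memLp
        ((hf_meas θ₀ hθ₀).sub (hf_meas θ hθ)).aestronglyMeasurable).1
        ((hvar θ hθ hle).trans_lt ENNReal.ofReal_lt_top)
  have hdec : ∀ θ ∈ Θ, (fun x => f₁ x θ - f₁ x θ₀) =
      -((fun x => f x θ₀ - f x θ) + fun x => f₂ x θ) := fun θ hθ => by
    ext x
    simp only [Pi.neg_apply, Pi.add_apply]
    rw [hsplit x θ hθ, hsplit x θ₀ hθ₀, hf₂0]; ring
  have hd_memLp : ∀ θ ∈ Θ, ‖θ - θ₀‖ ≤ ε → MemLp (fun x => f₁ x θ - f₁ x θ₀) 2 p :=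
    fun θ hθ hle => by
      rw [hdec θ hθ]
      exact ((hF_memLp θ hθ hle).add (hf₂_memLp θ hθ hle)).neg
  -- Square-integrability of the differences is known only near θ₀, so the evaluation points must be
  -- taken there.
  set T := {θ : Θ // ‖(θ : EuclideanSpace ℝ (Fin D)) - θ₀‖ ≤ ε} with hT
  set V : Submodule ℝ (T → ℝ) :=
    (differenceSpan Θ f₁ θ₀).map (LinearMap.funLeft ℝ ℝ (Subtype.val : T → Θ)) with hV
  obtain ⟨d, t, a, ha⟩ := exists_evaluation_expansion V
  have hexp : ∀ x (s : T), f₁ x s.1 - f₁ x θ₀ = ∑ i, a s i * (f₁ x (t i).1 - f₁ x θ₀) :=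
    fun x s => ha (fun s => f₁ x s.1 - f₁ x θ₀)
      ⟨fun θ : Θ => f₁ x θ - f₁ x θ₀, Submodule.subset_span ⟨x, rfl⟩, rfl⟩ s
  -- R is whitened together with the potentials, so that matching the sum of e also matches the sum
  -- of R.
  set ψ : Option (Fin d) → 𝒳 → ℝ := fun o => o.elim R fun i x => f₁ x (t i).1 - f₁ x θ₀ with hψ
  have hψ_memLp : ∀ o, MemLp (ψ o) 2 p := by
    rintro (_ | i)
    · exact hR_sq
    · exact hd_memLp _ (t i).1.2 (t i).2
  obtain ⟨k, e, c, he, hc⟩ := exists_isWhite hψ_memLp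
  have hcm : ∀ᵐ x ∂p, ∀ o, ψ o x = ∫ y, ψ o y ∂p + inner ℝ (c o) (e x) := ae_all_iff.2 hc
  set b : EuclideanSpace ℝ (Fin D) → EuclideanSpace ℝ (Fin k) := fun θ =>
    if h : θ ∈ Θ ∧ ‖θ - θ₀‖ ≤ ε then ∑ i, a ⟨⟨θ, h.1⟩, h.2⟩ i • c (some i) else 0 with hb
  set m : EuclideanSpace ℝ (Fin D) → ℝ := fun θ => ∫ x, (f₁ x θ - f₁ x θ₀) ∂p with hm
  have hmain : ∀ᵐ x ∂p, ∀ θ ∈ Θ, ‖θ - θ₀‖ ≤ ε →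
      f₁ x θ - f₁ x θ₀ = m θ + inner ℝ (b θ) (e x) := by
    filter_upwards [hcm] with x hx θ hθ hle
    set s : T := ⟨⟨θ, hθ⟩, hle⟩
    have hms : m θ = ∑ i, a s i * ∫ y, ψ (some i) y ∂p := by
      have : ∀ y, f₁ y θ - f₁ y θ₀ = ∑ i, a s i * ψ (some i) y := fun y => hexp y s
      simp only [hm, this]
      rw [integral_finsetSum _ fun i _ => ((hψ_memLp (some i)).integrable one_le_two).const_mul _]
      simp only [integral_const_mul]
    have hbs : b θ = ∑ i, a s i • c (some i) := dif_pos ⟨hθ, hle⟩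
    rw [hms, hbs, sum_inner, ← Finset.sum_add_distrib, hexp x s]
    refine Finset.sum_congr rfl fun i _ => ?_
    rw [real_inner_smul_left, ← mul_add, ← hx (some i)]
    rfl
  set ER := ∫ y, R y ∂p with hER
  refine ⟨k, e, b, m, c none, √(2 * L₂ + 2 * (∫ y, R y ^ 2 ∂p) * r₀ ^ 2 * ε ^ 2), he,
    Real.sqrt_nonneg _, ?_, fun θ hθ hle => ⟨?_, ?_⟩⟩
  · filter_upwards [hmain, hcm] with x h1 h2
    exact ⟨h2 none, h1⟩
  · have hF := hF_memLp θ hθ hle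
    have hG := hf₂_memLp θ hθ hle
    -- The identity covariance turns the norm of the coefficient into a variance, which the variance
    -- bounds for f and f₂ control.
    have h1 : ‖b θ‖ ^ 2 = variance (fun x => f₁ x θ - f₁ x θ₀) p := by
      rw [variance_eq_integral (hd_memLp θ hθ hle).1.aemeasurable, ← he.integral_sq]
      refine integral_congr_ae ?_
      filter_upwards [hmain] with x hx
      rw [hx θ hθ hle]
      simp only [hm]
      ring
    have h2 : variance (fun x => f x θ₀ - f x θ) p ≤ L₂ * ‖θ - θ₀‖ ^ 2 :=
      ENNReal.toReal_le_of_le_ofReal (by positivity) (hvar θ hθ hle)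
    have h3 : variance (fun x => f₂ x θ) p ≤
        (∫ y, R y ^ 2 ∂p) * r₀ ^ 2 * ε ^ 2 * ‖θ - θ₀‖ ^ 2 := by
      refine (variance_le_expectation_sq hG.1).trans ?_
      have h4 : ∀ x, f₂ x θ ^ 2 ≤ R x ^ 2 * (r₀ ^ 2 * ε ^ 2 * ‖θ - θ₀‖ ^ 2) := fun x => by
        have h5 := hrem x θ hθ hle
        -- One factor ‖θ - θ₀‖ is traded for ε, making the remainder linear in the distance.
        have h6 : R x * r₀ * ‖θ - θ₀‖ ^ 2 ≤ R x * (r₀ * ε * ‖θ - θ₀‖) := by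
          have := (hR_pos x).le
          rw [mul_assoc]
          refine mul_le_mul_of_nonneg_left ?_ this
          rw [sq, mul_assoc]
          gcongr
        have h7 := pow_le_pow_left₀ (abs_nonneg _) (h5.trans h6) 2
        rw [sq_abs] at h7
        calc _ ≤ _ := h7
          _ = _ := by ring
      calc ∫ x, f₂ x θ ^ 2 ∂p ≤ ∫ x, R x ^ 2 * (r₀ ^ 2 * ε ^ 2 * ‖θ - θ₀‖ ^ 2) ∂p :=
            integral_mono hG.integrable_sq (hR_sq.integrable_sq.mul_const _) h4
        _ = _ := by rw [integral_mul_const]; ring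
    have h4 : ‖b θ‖ ^ 2 ≤ (2 * L₂ + 2 * (∫ y, R y ^ 2 ∂p) * r₀ ^ 2 * ε ^ 2) * ‖θ - θ₀‖ ^ 2 := by
      rw [h1, hdec θ hθ, variance_neg]
      refine (variance_add_le hF hG).trans ?_
      linarith
    rw [← Real.sqrt_sq (norm_nonneg (b θ)), ← Real.sqrt_sq (norm_nonneg (θ - θ₀)),
      ← Real.sqrt_mul' _ (sq_nonneg _)]
    exact Real.sqrt_le_sqrt h4
  · have hF := (hF_memLp θ hθ hle).integrable one_le_two
    have hG := (hf₂_memLp θ hθ hle).integrable one_le_two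
    have h1 : m θ = -((meanPotential p f θ₀ - meanPotential p f θ) + ∫ x, f₂ x θ ∂p) := by
      simp only [hm]
      rw [hdec θ hθ]
      rw [integral_neg', integral_add' hF hG, integral_sub (hf_int θ₀ hθ₀) (hf_int θ hθ)]
      rfl
    have h2 : |∫ x, f₂ x θ ∂p| ≤ ER * (r₀ * ‖θ - θ₀‖ ^ 2) := by
      rw [hER, ← integral_mul_const]
      refine (norm_integral_le_integral_norm _).trans
        (integral_mono_ae hG.norm ((hR_sq.integrable one_le_two).mul_const _)
          (ae_of_all _ fun x => ?_))
      simp only [Real.norm_eq_abs]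
      linarith [hrem x θ hθ hle]
    rw [h1, abs_neg]
    refine (abs_add_le _ _).trans ?_
    linarith [hmean θ hθ hle]

end LocalExpansion

/-! ### Deterministic estimates for weighted sums. -/

section WeightedSums

lemma sum_weighted_le {N k : ℕ} {v R : Fin N → ℝ} {e : Fin N → EuclideanSpace ℝ (Fin k)}
    {c a : ℝ} {ξ : EuclideanSpace ℝ (Fin k)} (hN : 1 ≤ N) (hv : ∑ n, v n = (N : ℝ))
    (hR : ∀ n, R n = c + inner ℝ ξ (e n)) (ha : 0 ≤ a) (he : ‖∑ n, v n • e n‖ ≤ a * √N) :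
    ∑ n, v n * R n ≤ (c + ‖ξ‖ * a) * N := by
  have hN' : (1 : ℝ) ≤ N := by exact_mod_cast hN
  have h1 : ∑ n, v n * R n = N * c + inner ℝ ξ (∑ n, v n • e n) := by
    simp only [hR, mul_add, Finset.sum_add_distrib, ← Finset.sum_mul, hv, inner_sum,
      inner_smul_right]
  have h2 : inner ℝ ξ (∑ n, v n • e n) ≤ ‖ξ‖ * (a * N) := by
    refine (real_inner_le_norm _ _).trans (mul_le_mul_of_nonneg_left (he.trans ?_) (norm_nonneg _))
    gcongr
    exact (Real.sqrt_le_left (by positivity)).2 (by nlinarith)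
  rw [h1]; linarith

lemma abs_sum_weighted_le {N : ℕ} {v R F : Fin N → ℝ} {s G : ℝ} (hv : ∀ n, 0 ≤ v n) (hs : 0 ≤ s)
    (hF : ∀ n, |F n| ≤ R n * s) (hG : ∑ n, v n * R n ≤ G) : |∑ n, v n * F n| ≤ G * s := by
  calc |∑ n, v n * F n| ≤ ∑ n, |v n * F n| := Finset.abs_sum_le_sum_abs _ _
    _ ≤ ∑ n, v n * R n * s := Finset.sum_le_sum fun n _ => by
        rw [abs_mul, abs_of_nonneg (hv n), mul_assoc]
        exact mul_le_mul_of_nonneg_left (hF n) (hv n)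
    _ ≤ G * s := by
        rw [← Finset.sum_mul]; exact mul_le_mul_of_nonneg_right hG hs

lemma sum_weighted_expansion {N k : ℕ} {v F F₁ F₂ : Fin N → ℝ}
    {e : Fin N → EuclideanSpace ℝ (Fin k)} {m : ℝ} {b : EuclideanSpace ℝ (Fin k)}
    (hv : ∑ n, v n = (N : ℝ)) (hF : ∀ n, F n = F₁ n + F₂ n)
    (h₁ : ∀ n, F₁ n = m + inner ℝ b (e n)) :
    ∑ n, v n * F n = N * m + inner ℝ b (∑ n, v n • e n) + ∑ n, v n * F₂ n := by
  simp only [hF, h₁, mul_add, Finset.sum_add_distrib, ← Finset.sum_mul, hv, inner_sum,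
      inner_smul_right]

/-- The difference of two weighted sums with the same total weight `N` is polynomially bounded by
the squared deviations from any center. -/
lemma enorm_sum_sub_sum_le {N : ℕ} (hN : 1 ≤ N) {w Y : Fin N → ℝ} (hw0 : ∀ n, 0 ≤ w n)
    (hwN : ∀ n, w n ≤ N) (hw : ∑ n, w n = (N : ℝ)) (c : ℝ) :
    ‖∑ n, w n * Y n - ∑ n, 1 * Y n‖ₑ ≤
      (N : ℝ≥0∞) * (N + ∑ n, ‖(-Y n) - c‖ₑ ^ 2) := by
  have hN' : (1 : ℝ) ≤ N := by exact_mod_cast hN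
  -- Both weightings have total N, so any constant c may be subtracted; with c the mean, the terms
  -- become the deviations entering the variance.
  have h1 : ∑ n, w n * Y n - ∑ n, 1 * Y n = -∑ n, (w n - 1) * (-Y n - c) := by
    have : ∑ n, (w n - 1) = 0 := by rw [Finset.sum_sub_distrib, hw]; simp
    simp only [mul_sub, Finset.sum_sub_distrib, ← Finset.sum_mul, this]
    simp only [sub_mul, mul_neg, Finset.sum_sub_distrib, Finset.sum_neg_distrib]
    ring
  have h2 : ‖∑ n, w n * Y n - ∑ n, 1 * Y n‖ ≤ N * (N + ∑ n, ‖-Y n - c‖ ^ 2) := by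
    rw [h1, norm_neg]
    calc ‖∑ n, (w n - 1) * (-Y n - c)‖ ≤ ∑ n, ‖(w n - 1) * (-Y n - c)‖ := norm_sum_le _ _
      _ ≤ ∑ n, N * (1 + ‖-Y n - c‖ ^ 2) := Finset.sum_le_sum fun n _ => by
          rw [norm_mul]
          refine mul_le_mul ?_ ?_ (norm_nonneg _) (by positivity)
          · rw [Real.norm_eq_abs, abs_le]
            constructor <;> linarith [hw0 n, hwN n]
          · nlinarith [sq_nonneg (‖-Y n - c‖ - 1), norm_nonneg (-Y n - c)]
      _ = _ := by
          rw [← Finset.mul_sum, Finset.sum_add_distrib]; simp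
  rw [← ofReal_norm]
  refine (ENNReal.ofReal_le_ofReal h2).trans (le_of_eq ?_)
  rw [ENNReal.ofReal_mul (by positivity), ENNReal.ofReal_add (by positivity) (by positivity),
    ENNReal.ofReal_natCast, ENNReal.ofReal_sum_of_nonneg fun _ _ => by positivity]
  congr 2
  refine Finset.sum_congr rfl fun n _ => ?_
  rw [ENNReal.ofReal_pow (norm_nonneg _), ofReal_norm]

end WeightedSums


/-! ### Assembly of the main theorem. -/

theorem theorem2
    {𝒳 : Type*} [MeasurableSpace 𝒳] (p : Measure 𝒳) [IsProbabilityMeasure p]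
    (D : ℕ) (hD : 1 ≤ D)
    -- the parameter space, the prior density and the potentials
    (Θ : Set (EuclideanSpace ℝ (Fin D))) (hΘ : MeasurableSet Θ)
    (π₀ : EuclideanSpace ℝ (Fin D) → ℝ) (hπ₀_meas : Measurable π₀)
    (hπ₀_nonneg : ∀ θ ∈ Θ, 0 ≤ π₀ θ)
    (hπ₀_one : ∫⁻ θ in Θ, ENNReal.ofReal (π₀ θ) = 1)
    (f f₁ f₂ : 𝒳 → EuclideanSpace ℝ (Fin D) → ℝ)
    (hf_meas : ∀ θ ∈ Θ, Measurable (fun x => f x θ))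
    (hf₁_meas : ∀ θ ∈ Θ, Measurable (fun x => f₁ x θ))
    (hf_int : ∀ θ ∈ Θ, Integrable (fun x => f x θ) p)
    -- the maximizer of the expected potential
    (θ₀ : EuclideanSpace ℝ (Fin D)) (hθ₀ : θ₀ ∈ Θ)
    (hmax : ∀ θ ∈ Θ, meanPotential p f θ ≤ meanPotential p f θ₀)
    -- the split of the potentials
    (hsplit : ∀ x, ∀ θ ∈ Θ, f x θ = f₁ x θ + f₂ x θ)
    (hfin : FiniteDimensional ℝ (differenceSpan Θ f₁ θ₀))
    (ε₀ L₀ L₁ L₂ : ℝ) (hε₀ : 0 < ε₀) (hL₀ : 0 < L₀) (hL₁ : 0 < L₁) (hL₂ : 0 < L₂)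
    -- A1
    (hA1_diff : ∀ x, DifferentiableOn ℝ (f x) Θ)
    (hA1_concave : ∀ x, StrongConcaveOn Θ L₀ (f x))
    -- A2
    (R : 𝒳 → ℝ) (r : ℝ → ℝ)
    (hR_pos : ∀ x, 0 < R x) (hR_sq : MemLp R 2 p)
    (hr_pos : ∀ ε ∈ Set.Ioc 0 ε₀, 0 < r ε) (hr_mono : MonotoneOn r (Set.Ioc 0 ε₀))
    (hr_lim : Tendsto r (𝓝[>] 0) (𝓝 0))
    (hA2 : ∀ x, ∀ ε ∈ Set.Ioo 0 ε₀, ∀ θ ∈ Θ, ‖θ - θ₀‖ ≤ ε →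
      |f₂ x θ| ≤ R x * r ε * ‖θ - θ₀‖ ^ 2)
    (hA2_const : 4 * r ε₀ * ((∫ x, R x ∂p) + 1) ≤ L₀)
    -- A3
    (hA3_mean : ∀ θ ∈ Θ, ‖θ - θ₀‖ ≤ ε₀ →
      meanPotential p f θ₀ - meanPotential p f θ ≤ L₁ * ‖θ - θ₀‖ ^ 2)
    (hA3_var : ∀ θ ∈ Θ, ‖θ - θ₀‖ ≤ ε₀ →
      evariance (fun x => f x θ₀ - f x θ) p ≤ ENNReal.ofReal (L₂ * ‖θ - θ₀‖ ^ 2))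
    -- A4
    (hA4_inf : ∃ c : ℝ, 0 < c ∧ ∀ θ ∈ Θ, ‖θ - θ₀‖ ≤ ε₀ → c ≤ π₀ θ)
    (hA4_sup : ∃ B : ℝ, ∀ θ ∈ Θ, π₀ θ ≤ B)
    -- the prior-averaged variance of the potential differences is finite, possibly only after
    -- multiplication with a Gaussian factor
    (hvar : ∃ K : ℝ, 0 ≤ K ∧
      ∫⁻ θ in Θ, evariance (fun x => f x θ₀ - f x θ) p *
        ENNReal.ofReal (Real.exp (-K * ‖θ - θ₀‖ ^ 2) * π₀ θ) < ∞)
    -- the coreset sizes: `M ≳ D (log N + 1)`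
    (M : ℕ → ℕ) (c : ℝ) (hc : 0 < c)
    (hM : ∀ᶠ N : ℕ in atTop, c * (D * (Real.log N + 1)) ≤ (M N : ℝ))
    (hMN : ∀ᶠ N : ℕ in atTop, M N ≤ N) :
    -- outside an event of probability `o(1)`, the minimum over the weights is attained and is at
    -- most the deterministic `κ N = o(1)`
    ∃ κ : ℕ → ℝ≥0∞, Tendsto κ atTop (𝓝 0) ∧
      Tendsto (fun N : ℕ => sampleLaw p N (M N)
        {ω | ¬ ∃ v, IsLeast (coresetKLValues Θ f π₀ ω.1 ω.2) v ∧ v ≤ κ N}) atTop (𝓝 0) := by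

  classical
  -- the prior is a probability measure, and the potentials are bounded above and measurable on `Θ`
  obtain ⟨cπ, hcπ, hlow⟩ := hA4_inf
  obtain ⟨B, hB⟩ := hA4_sup
  obtain ⟨K, hK, hvarK⟩ := hvar
  have hprior : IsProbabilityMeasure (priorMeasure Θ π₀) := ⟨by
    rw [priorMeasure, withDensity_apply _ MeasurableSet.univ, Measure.restrict_univ, hπ₀_one]⟩
  obtain ⟨x₀⟩ : Nonempty 𝒳 := nonempty_of_isProbabilityMeasure p
  have hconv : Convex ℝ Θ := (hA1_concave x₀).1
  have hfcont : ∀ x, ContinuousOn (f x) Θ := fun x => (hA1_diff x).continuousOn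
  have hfm : ∀ x, AEMeasurable (f x) (volume.restrict Θ) := fun x => (hfcont x).aemeasurable hΘ
  choose Cf hCf using fun x => (hA1_concave x).bddAbove_of_differentiableWithinAt hL₀ hθ₀
    (hA1_diff x θ₀ hθ₀)
  -- the local expansion on the ball of radius `ε₀ / 2`
  set ε₂ := ε₀ / 2 with hε₂
  have hε₂pos : 0 < ε₂ := by positivity
  -- The remainder bound is available only at radii strictly below ε₀; hence the halving.
  have hε₂lt : ε₂ < ε₀ := by rw [hε₂]; linarith
  have hr₂ : 0 < r ε₂ := hr_pos ε₂ ⟨hε₂pos, hε₂lt.le⟩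
  obtain ⟨k, e, b, m, ξ, C₀, he, hC₀, hexp, hbm⟩ := exists_isWhite_expansion (L₁ := L₁) hf_meas
    hf₁_meas hf_int hθ₀ hsplit hfin hε₂pos hL₂.le hr₂.le hR_pos hR_sq
    (fun x θ hθ hle => hA2 x ε₂ ⟨hε₂pos, hε₂lt⟩ θ hθ hle)
    (fun θ hθ hle => by
      rw [abs_of_nonneg (sub_nonneg.2 (hmax θ hθ))]
      exact hA3_mean θ hθ (hle.trans hε₂lt.le))
    (fun θ hθ hle => hA3_var θ hθ (hle.trans hε₂lt.le))
  set ER := ∫ y, R y ∂p with hER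
  have hER0 : 0 ≤ ER := integral_nonneg fun x => (hR_pos x).le
  have hf₂0 : ∀ x, f₂ x θ₀ = 0 := fun x => by
    simpa using hA2 x ε₂ ⟨hε₂pos, hε₂lt⟩ θ₀ hθ₀ (by simpa using hε₂pos.le)
  -- the exceptional sets of data
  obtain ⟨𝒜, δ, hδ, h𝒜, hdir⟩ := he.exists_finset_events
  obtain ⟨𝒩, h𝒩sub, -, h𝒩⟩ := exists_measurable_superset_of_null (ae_iff.1 hexp)
  have hgood : ∀ x, x ∉ 𝒩 → R x = ER + inner ℝ ξ (e x) ∧ ∀ θ ∈ Θ, ‖θ - θ₀‖ ≤ ε₂ →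
      f₁ x θ - f₁ x θ₀ = m θ + inner ℝ (b θ) (e x) := fun x hx => by
    by_contra h; exact hx (h𝒩sub h)
  have hMtop : Tendsto M atTop atTop := by
    have h1 : Tendsto (fun N : ℕ => c * (D * (Real.log N + 1))) atTop atTop := by
      have hD' : (0 : ℝ) < D := by exact_mod_cast hD
      exact ((tendsto_atTop_add_const_right _ 1
        (Real.tendsto_log_atTop.comp tendsto_natCast_atTop_atTop)).const_mul_atTop
        hD').const_mul_atTop hc
    exact tendsto_natCast_atTop_iff.1 (tendsto_atTop_mono' _ hM h1)
  set wt : EuclideanSpace ℝ (Fin D) → ℝ≥0∞ := fun θ =>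
    ENNReal.ofReal (Real.exp (-K * ‖θ - θ₀‖ ^ 2) * π₀ θ) with hwt
  have hwtm : Measurable wt := by
    refine Measurable.ennreal_ofReal (Measurable.mul ?_ hπ₀_meas)
    fun_prop
  obtain ⟨hdevm, hQm, hQint⟩ := lintegral_evariance_eq (F := fun x θ => f x θ₀ - f x θ) p hΘ
    (fun x => continuousOn_const.sub (hfcont x)) (fun θ hθ => (hf_meas θ₀ hθ₀).sub (hf_meas θ hθ))
    hwtm
  set Q : 𝒳 → ℝ≥0∞ := fun x =>
    ∫⁻ θ in Θ, ‖(f x θ₀ - f x θ) - ∫ y, (f y θ₀ - f y θ) ∂p‖ₑ ^ 2 * wt θ with hQ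
  have hQfin : ∫⁻ x, Q x ∂p ≠ ∞ := by rw [hQint]; exact hvarK.ne
  -- it suffices to bound the probability of a divergence above a fixed positive level
  refine exists_tendsto_zero_of_forall_level
    (P := fun N κ => sampleLaw p N (M N)
      {ω | ¬ ∃ v, IsLeast (coresetKLValues Θ f π₀ ω.1 ω.2) v ∧ v ≤ κ}) fun l => ?_
  rw [ENNReal.tendsto_nhds_zero]
  intro q hq
  obtain ⟨A, hApos, hA⟩ : ∃ A : ℝ, 0 < A ∧ ENNReal.ofReal (k / A) ≤ q / 2 := by
    have h : Tendsto (fun A : ℝ => ENNReal.ofReal (k / A)) atTop (𝓝 0) := by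
      rw [← ENNReal.ofReal_zero]
      exact (ENNReal.continuous_ofReal.tendsto _).comp (tendsto_const_nhds.div_atTop tendsto_id)
    obtain ⟨A, h1, h2⟩ := ((h.eventually_le_const (ENNReal.half_pos hq.ne')).and
      (eventually_gt_atTop 0)).exists
    exact ⟨A, h2, h1⟩
  -- G N will bound both ∑ w_n R(x_n) and ∑ R(x_n) for data outside the exceptional event of level
  -- A.
  set G := ER + ‖ξ‖ * √A with hG
  have hG0 : 0 ≤ G := by positivity
  obtain ⟨C, hC, hlap⟩ := exists_lintegral_tilted_le (a := C₀ * √A)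
    (b := L₁ + r ε₂ * ER + G * r ε₂) (K := K) hΘ hconv hθ₀ hπ₀_meas hprior hcπ
    (fun θ hθ hle => hlow θ hθ (hle.trans hε₂lt.le)) hB hε₂pos hL₀ (by positivity) (by positivity)
  -- Chosen so that the two means, each at most C τ, add up to the level 1/(l+1).
  set τ : ℝ := ((l : ℝ) + 1)⁻¹ / 2 / C with hτ
  have hτpos : 0 < τ := by positivity
  obtain ⟨ε, hε, hεr⟩ : ∃ ε, ε ∈ Set.Ioc 0 ε₂ ∧ 2 * G * r ε ≤ τ := by
    have h1 : Tendsto (fun ε => 2 * G * r ε) (𝓝[>] 0) (𝓝 0) := by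
      simpa using hr_lim.const_mul (2 * G)
    have h2 : ∀ᶠ ε in 𝓝[>] (0 : ℝ), ε ∈ Set.Ioc 0 ε₂ := Ioc_mem_nhdsGT hε₂pos
    exact (h2.and (h1.eventually_le_const hτpos)).exists
  have hεmem : ε ∈ Set.Ioo 0 ε₀ := ⟨hε.1, hε.2.trans_lt hε₂lt⟩
  -- Hitting the whole space, inserted among the events, says that the subset is nonempty.
  have hbad : Tendsto (fun N : ℕ => (∑ A ∈ insert Set.univ 𝒜,
      sampleLaw p N (M N) {ω | ∀ n ∈ ω.2, ω.1 n ∉ A}) + (∫⁻ x, Q x ∂p) / N) atTop (𝓝 0) := by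
    have h1 : Tendsto (fun N : ℕ => ∑ A ∈ insert Set.univ 𝒜,
        sampleLaw p N (M N) {ω | ∀ n ∈ ω.2, ω.1 n ∉ A}) atTop (𝓝 0) := by
      rw [← Finset.sum_const_zero (s := insert Set.univ 𝒜)]
      refine tendsto_finsetSum _ fun A hA => ?_
      rcases Finset.mem_insert.1 hA with rfl | h
      · exact tendsto_sampleLaw_forall_notMem hMtop MeasurableSet.univ (by simp)
      · exact tendsto_sampleLaw_forall_notMem hMtop (h𝒜 A h).1 (h𝒜 A h).2
    have h2 : Tendsto (fun N : ℕ => (∫⁻ x, Q x ∂p) / N) atTop (𝓝 0) := by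
      simpa using ENNReal.Tendsto.const_div ENNReal.tendsto_nat_nhds_top (Or.inr hQfin)
    simpa using h1.add h2
  have hNδ : ∀ᶠ N : ℕ in atTop, √A / δ ≤ √N :=
    (Real.tendsto_sqrt_atTop.comp tendsto_natCast_atTop_atTop).eventually_ge_atTop _
  filter_upwards [hlap ε hε τ hτpos, hbad.eventually_le_const (ENNReal.half_pos hq.ne'), hNδ,
    eventually_ge_atTop 2] with N hlapN hbadN hNδ hN2
  have hN1 : 1 ≤ N := by omega
  have hN' : (1 : ℝ) ≤ N := by exact_mod_cast hN1
  have hsN : √(N : ℝ) ^ 2 = N := Real.sq_sqrt (by linarith)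
  -- Four exceptions: a large sum of e, a missed event, a point violating the expansion, and large
  -- averaged squared deviations.
  have hincl : {ω : (Fin N → 𝒳) × Finset (Fin N) |
      ¬ ∃ v, IsLeast (coresetKLValues Θ f π₀ ω.1 ω.2) v ∧ v ≤ ((l : ℝ≥0∞) + 1)⁻¹} ⊆
      {ω | ω.1 ∈ {x | A * N ≤ ‖∑ n, e (x n)‖ ^ 2}} ∪
      ((⋃ A ∈ insert Set.univ 𝒜, {ω | ∀ n ∈ ω.2, ω.1 n ∉ A}) ∪
      ({ω | ω.1 ∈ {x | ∃ n, x n ∈ 𝒩}} ∪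
        {ω | ω.1 ∈ {x | (N : ℝ≥0∞) ^ 2 ≤ ∑ n, Q (x n)}})) := by
    rintro ⟨x, S⟩ hω
    by_contra hnot
    refine hω ?_
    simp only [Set.mem_union, Set.mem_iUnion, Set.mem_ofPred_eq, not_or, not_exists, not_and,
      not_forall, not_not, not_le, exists_prop] at hnot
    obtain ⟨hsum, hhit, hx𝒩, hxQ⟩ := hnot
    have hSne : S.Nonempty := by
      obtain ⟨n, hn, -⟩ := hhit Set.univ (Finset.mem_insert_self _ _)
      exact ⟨n, hn⟩
    have hyA : ‖∑ n, e (x n)‖ ≤ √A * √N := by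
      rw [← Real.sqrt_mul hApos.le]
      exact Real.le_sqrt_of_sq_le hsum.le
    obtain ⟨w, hw, hwe⟩ := exists_coresetWeights_sum_eq hdir hSne
      (fun A hA => hhit A (Finset.mem_insert_of_mem hA)) (y := ∑ n, e (x n)) (hyA.trans (by
        rw [div_le_iff₀ hδ] at hNδ
        nlinarith [Real.sqrt_nonneg (N : ℝ)]))
    obtain ⟨v, hv⟩ := exists_isLeast_coresetKLValues hπ₀_meas hΘ hfm hCf x hSne
    refine ⟨v, hv, ?_⟩
    have hvle : v ≤ InformationTheory.klDiv (coresetPosterior Θ f π₀ x w)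
        (fullPosterior Θ f π₀ x) := hv.2 ⟨w, hw, rfl⟩
    set g : (Fin N → ℝ) → EuclideanSpace ℝ (Fin D) → ℝ := fun u θ =>
      ∑ n, u n * (f (x n) θ - f (x n) θ₀) with hg
    set one : Fin N → ℝ := fun _ => 1 with hone
    have hone_mem : one ∈ coresetWeights Finset.univ := one_mem_coresetWeights_univ
    -- the local expansion of the weighted sums
    have hf₂le : ∀ n, ∀ s ∈ Set.Ioo 0 ε₀, ∀ θ ∈ Θ, ‖θ - θ₀‖ ≤ s →
        |f₂ (x n) θ| ≤ R (x n) * (r s * ‖θ - θ₀‖ ^ 2) := fun n s hs θ hθ hle => by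
      rw [← mul_assoc]; exact hA2 (x n) s hs θ hθ hle
    have hRsum : ∀ {T : Finset (Fin N)}, ∀ u ∈ coresetWeights T,
        ∑ n, u n • e (x n) = ∑ n, e (x n) → ∑ n, u n * R (x n) ≤ G * N := fun u hu hue =>
      sum_weighted_le hN1 hu.2.2 (fun n => (hgood _ (hx𝒩 n)).1) (Real.sqrt_nonneg A)
        (by rw [hue]; exact hyA)
    have hexpand : ∀ {T : Finset (Fin N)}, ∀ u ∈ coresetWeights T,
        ∑ n, u n • e (x n) = ∑ n, e (x n) → ∀ θ ∈ Θ, ‖θ - θ₀‖ ≤ ε₂ →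
        g u θ = N * m θ + inner ℝ (b θ) (∑ n, e (x n)) + ∑ n, u n * f₂ (x n) θ :=
      fun u hu hue θ hθ hle => by
        rw [← hue]
        refine sum_weighted_expansion hu.2.2 (F₁ := fun n => f₁ (x n) θ - f₁ (x n) θ₀)
          (fun n => ?_) (fun n => (hgood _ (hx𝒩 n)).2 θ hθ hle)
        rw [hsplit _ θ hθ, hsplit _ θ₀ hθ₀, hf₂0]; ring
    have hgloc : ∀ {T : Finset (Fin N)}, ∀ u ∈ coresetWeights T,
        ∑ n, u n • e (x n) = ∑ n, e (x n) → ∀ θ ∈ Θ, ‖θ - θ₀‖ ≤ ε →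
        |g u θ| ≤ C₀ * √A * √N * ‖θ - θ₀‖ + (L₁ + r ε₂ * ER + G * r ε₂) * N * ‖θ - θ₀‖ ^ 2 :=
      fun u hu hue θ hθ hle => by
        have hle₂ := hle.trans hε.2
        rw [hexpand u hu hue θ hθ hle₂]
        have h1 : |N * m θ| ≤ N * ((L₁ + r ε₂ * ER) * ‖θ - θ₀‖ ^ 2) := by
          rw [abs_mul, Nat.abs_cast]
          exact mul_le_mul_of_nonneg_left (hbm θ hθ hle₂).2 (Nat.cast_nonneg N)
        have h2 : |inner ℝ (b θ) (∑ n, e (x n))| ≤ C₀ * ‖θ - θ₀‖ * (√A * √N) :=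
          (abs_real_inner_le_norm _ _).trans
            (mul_le_mul (hbm θ hθ hle₂).1 hyA (norm_nonneg _) (by positivity))
        have h3 : |∑ n, u n * f₂ (x n) θ| ≤ G * N * (r ε₂ * ‖θ - θ₀‖ ^ 2) :=
          abs_sum_weighted_le hu.1 (by positivity)
            (fun n => hf₂le n ε₂ ⟨hε₂pos, hε₂lt⟩ θ hθ hle₂) (hRsum u hu hue)
        calc _ ≤ |N * m θ| + |inner ℝ (b θ) (∑ n, e (x n))| + |∑ n, u n * f₂ (x n) θ| :=
              abs_add_three _ _ _
          _ ≤ _ := by linarith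
    have hone_e : ∑ n, one n • e (x n) = ∑ n, e (x n) := by simp [hone]
    have hhloc : ∀ θ ∈ Θ, ‖θ - θ₀‖ ≤ ε → |g w θ - g one θ| ≤ τ * N * ‖θ - θ₀‖ ^ 2 :=
      fun θ hθ hle => by
        have hr0 : 0 < r ε := hr_pos ε ⟨hε.1, hεmem.2.le⟩
        rw [hexpand w hw hwe θ hθ (hle.trans hε.2), hexpand one hone_mem hone_e θ hθ
          (hle.trans hε.2), add_sub_add_left_eq_sub]
        have h1 := abs_sum_weighted_le hw.1 (by positivity)
          (fun n => hf₂le n ε hεmem θ hθ hle) (hRsum w hw hwe)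
        have h2 := abs_sum_weighted_le hone_mem.1 (by positivity)
          (fun n => hf₂le n ε hεmem θ hθ hle) (hRsum one hone_mem hone_e)
        calc _ ≤ _ := abs_sub _ _
          _ ≤ 2 * G * r ε * (N * ‖θ - θ₀‖ ^ 2) := by linarith
          _ ≤ τ * (N * ‖θ - θ₀‖ ^ 2) := by gcongr
          _ = _ := by ring
    -- the contribution of distant parameters
    have hfar : ∫⁻ θ, ‖g w θ - g one θ‖ₑ * ENNReal.ofReal (Real.exp (-K * ‖θ - θ₀‖ ^ 2))
        ∂(priorMeasure Θ π₀) ≤ ENNReal.ofReal ((N : ℝ) ^ 4) := by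
      set dev : Fin N → EuclideanSpace ℝ (Fin D) → ℝ≥0∞ := fun n θ =>
        ‖(f (x n) θ₀ - f (x n) θ) - ∫ y, (f y θ₀ - f y θ) ∂p‖ₑ ^ 2 with hdev
      have hwt_le : ∫⁻ θ in Θ, wt θ ≤ 1 := by
        rw [← hπ₀_one]
        refine setLIntegral_mono_ae' hΘ (ae_of_all _ fun θ hθ => ENNReal.ofReal_le_ofReal ?_)
        refine mul_le_of_le_one_left (hπ₀_nonneg θ hθ) (Real.exp_le_one_iff.2 ?_)
        have : 0 ≤ K * ‖θ - θ₀‖ ^ 2 := by positivity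
        linarith
      rw [priorMeasure, lintegral_withDensity_eq_lintegral_mul_non_measurable _
        hπ₀_meas.ennreal_ofReal (ae_of_all _ fun _ => ENNReal.ofReal_lt_top)]
      calc _ ≤ ∫⁻ θ in Θ, (N * N * wt θ + N * ∑ n, dev n θ * wt θ) := by
            refine lintegral_mono fun θ => ?_
            have h1 := enorm_sum_sub_sum_le hN1 (Y := fun n => f (x n) θ - f (x n) θ₀) hw.1
              (le_of_mem_coresetWeights hw) hw.2.2 (∫ y, (f y θ₀ - f y θ) ∂p)
            simp only [neg_sub] at h1
            calc _ = ‖g w θ - g one θ‖ₑ * wt θ := by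
                  simp only [Pi.mul_apply, hwt]
                  rw [ENNReal.ofReal_mul (Real.exp_pos _).le]
                  ring
              _ ≤ N * (N + ∑ n, dev n θ) * wt θ := mul_le_mul_left h1 _
              _ = _ := by rw [← Finset.sum_mul]; ring
        _ = N * N * (∫⁻ θ in Θ, wt θ) + N * ∑ n, Q (x n) := by
            rw [lintegral_add_left (hwtm.const_mul _),
              lintegral_const_mul' _ _ (ENNReal.mul_ne_top (by simp) (by simp)),
              lintegral_const_mul' _ _ (by simp), lintegral_finsetSum' _ fun n _ => hdevm (x n)]
        _ ≤ N * N * 1 + N * (N : ℝ≥0∞) ^ 2 := by gcongr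
        _ ≤ ENNReal.ofReal ((N : ℝ) ^ 4) := by
            rw [ENNReal.ofReal_pow (Nat.cast_nonneg N), ENNReal.ofReal_natCast]
            norm_cast
            -- True from N = 2 on; this is why the fourth power suffices for the Gaussian moment.
            have h1 : 1 + N ≤ N * N := by nlinarith
            calc N * N * 1 + N * N ^ 2 = N * N * (1 + N) := by ring
              _ ≤ N * N * (N * N) := Nat.mul_le_mul_left _ h1
              _ = N ^ 4 := by ring
    have hconc : ∀ {T : Finset (Fin N)}, ∀ u ∈ coresetWeights T,
        StrongConcaveOn Θ (N * L₀) (g u) := fun u hu => by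
      rw [← hu.2.2]
      exact StrongConcaveOn.sum_smul_sub_const hconv (fun n => hA1_concave (x n)) hu.1 _
    have hgm : ∀ u, AEMeasurable (g u) (volume.restrict Θ) := fun u =>
      Finset.aemeasurable_fun_sum _ fun n _ => ((hfm (x n)).sub_const _).const_mul _
    have hg0 : ∀ u, g u θ₀ = 0 := fun u => by simp [hg]
    -- The same difference is integrated against both tilts: both exponents obey the same local
    -- bounds, as their weights have the same sum of e.
    obtain ⟨hiw, hbw⟩ := hlapN (g w) (fun θ => g w θ - g one θ) (hgm w) (hconc w hw) (hg0 w)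
      (hgloc w hw hwe) hhloc hfar
    obtain ⟨hi1, hb1⟩ := hlapN (g one) (fun θ => g w θ - g one θ) (hgm one)
      (hconc one hone_mem) (hg0 one) (hgloc one hone_mem hone_e) hhloc hfar
    calc v ≤ _ := hvle
      _ = InformationTheory.klDiv ((priorMeasure Θ π₀).tilted (g w))
            ((priorMeasure Θ π₀).tilted (g one)) := by
          rw [fullPosterior, coresetPosterior_eq_tilted_sub hπ₀_meas hΘ hfm hCf x hw θ₀,
            coresetPosterior_eq_tilted_sub hπ₀_meas hΘ hfm hCf x hone_mem θ₀]
      _ ≤ ENNReal.ofReal (C * τ) + ENNReal.ofReal (C * τ) :=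
          (klDiv_tilted_tilted_le (μ := priorMeasure Θ π₀) hi1 hiw).trans (add_le_add hbw hb1)
      _ = ((l : ℝ≥0∞) + 1)⁻¹ := by
          rw [← ENNReal.ofReal_add (by positivity) (by positivity)]
          have : C * τ + C * τ = ((l : ℝ) + 1)⁻¹ := by rw [hτ]; field_simp; norm_num
          rw [this, ENNReal.ofReal_inv_of_pos (by positivity),
            ENNReal.ofReal_add (Nat.cast_nonneg _) zero_le_one]
          simp
  refine (measure_mono hincl).trans ((measure_union_le _ _).trans ?_)
  rw [← ENNReal.add_halves q]
  refine add_le_add (((sampleLaw_fst_le _ _).trans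
    (he.measure_norm_sum_sq_ge_le (by omega) hApos)).trans hA) (le_trans ?_ hbadN)
  refine (measure_union_le _ _).trans (add_le_add (measure_biUnion_finset_le _ _)
    ((measure_union_le _ _).trans ?_))
  rw [← zero_add ((∫⁻ x, Q x ∂p) / N)]
  exact add_le_add ((sampleLaw_fst_le _ _).trans (pi_exists_mem_eq_zero h𝒩).le)
    ((sampleLaw_fst_le _ _).trans (pi_sq_le_sum_le (by omega) hQm))
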